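/- Let $V=\mathbb{Q}[t_1,t_2,t_3,\dots]$. For a partition $\rho=(1^{m_1}2^{m_2}\cdots)$ put $t^{(\rho)}=\prod_j t_j^{m_j}/m_j!$, and let $\ell(\rho)$ be its number of parts. Let $P(n)$, $SP(n)$, $OP(n)$ be the sets of all partitions of $n$, of those with distinct parts, and of those with odd parts. For $\lambda\in P(n)$ let $S_\lambda(t)=\sum_{\rho\in P(n)}\chi^\lambda_\rho\,t^{(\rho)}$ be the Schur function, where $\chi^\lambda$ is the irreducible character of the symmetric group $S_n$ attached to $\lambda$ (the character of the Specht module). For a strict partition $\lambda$ let $Q_\lambda(t)$ be Schur's $Q$-function: with $q_n(t)=\sum_{\rho\in OP(n)}t^{(\rho)}$ (that is, $\sum_n q_nz^n=\exp\sum_{j\text{ odd}}t_jz^j$) and $Q_{(a,b)}=q_aq_b+2\sum_{i=1}^{b}(-1)^iq_{a+i}q_{b-i}$ for $a>b\ge 0$, $Q_\lambda$ is the Pfaffian of the skew-symmetric matrix whose entries above the diagonal are $Q_{(\lambda_i,\lambda_j)}$, $i<j$, where a part $0$ is appended to $\lambda$ if $\ell(\lambda)$ is odd. For $\lambda\in P(n)$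 with multiplicities $m_i$, let $\lambda^r$ be the strict partition containing $i$ exactly when $m_i$ is odd, and let $\lambda^d$ be the partition in which $i$ has multiplicity $\lfloor m_i/2\rfloor$. For $n_0+2n_1=n$ let $P(n_0,n_1)$ be the set of those $\lambda\in P(n)$ for which $\lambda^r$ is a partition of $n_0$ and $\lambda^d$ a partition of $n_1$. For a strict partition $\mu$ let $\tilde\mu$ be the odd partition obtained by replacing each part $2^pq$ ($q$ odd) by $2^p$ parts equal to $q$; write $\tilde\lambda^r$ for $\widetilde{\lambda^r}$. Put $W_\lambda(t)=Q_{\lambda^r}(t)\,S_{\lambda^d}(t')$, where $t'$ means the substitution $t_j\mapsto t_{2j}$. Then for every $n\ge 0$ there is a unique rational matrix $A_n=(a_{\lambda\mu})_{\lambda,\mu\in P(n)}$ with $S_\lambda=\sum_{\mu\in P(n)}a_{\lambda\mu}W_\mu$ for all $\lambda\in P(n)$, and the following hold. 1. The matrix ${}^tA_nA_n$ is block diagonal, with blocks indexed by the pairs $(n_0,n_1)$ with $n_0+2n_1=n$: each $\lambda\in P(n)$ lies in exactly one of the sets $P(n_0,n_1)$, and $({}^tA_nA_n)_{\lambda\mu}=0$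 whenever $\lambda\in P(n_0,n_1)$ and $\mu\in P(m_0,m_1)$ with $(n_0,n_1)\neq(m_0,m_1)$. Let $B_{n_0,n_1}$ be the block with rows and columns in $P(n_0,n_1)$. 2. Let $\Gamma_n=(a_{\lambda\mu})_{\lambda\in P(n),\,\mu\in SP(n)}$ be the submatrix of the columns $(\mu,\emptyset)$, $\mu\in SP(n)$. Its entries are the Stembridge coefficients: $S_\lambda(t)|_{t_2=t_4=\cdots=0}=\sum_{\mu\in SP(n)}a_{\lambda\mu}Q_\mu(t)$ for all $\lambda\in P(n)$. Under the identification $P(n,0)=SP(n)$, the principal block is $B_{n,0}=G_n={}^t\Gamma_n\Gamma_n$. 3. For all $n_0,n_1\ge 0$ with $n_0+2n_1=n$, $$|\det B_{n_0,n_1}|=2^{\sum_{\lambda\in P(n_0,n_1)}\left(\ell(\tilde\lambda^r)-\ell(\lambda^r)+\ell(\lambda^d)\right)}.$$ -/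

import Mathlib

open scoped Matrix

noncomputable section

namespace Compound

/-! ## The space of symmetric functions -/

/-- The ring `V = ℚ[t_j ; j ≥ 1]`. -/
abbrev V : Type := MvPolynomial ℕ+ ℚ

/-- For a partition `ρ = (1^{m_1} 2^{m_2} ⋯)` of `n` the element
`t_1^{m_1} t_2^{m_2} ⋯ / (m_1! m_2! ⋯)` of `V`.  No part exceeds `n`, so the factors with
`j = i + 1`, `i < n`, are all of them. -/
def tMonomial {n : ℕ} (ρ : n.Partition) : V :=
  ∏ i ∈ Finset.range n,
    MvPolynomial.C (((ρ.parts.count (i + 1)).factorial : ℚ)⁻¹) *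
      MvPolynomial.X i.succPNat ^ ρ.parts.count (i + 1)

/-- The substitution `t_j ↦ t_{2j}`. -/
def doubleVars : V →ₐ[ℚ] V := MvPolynomial.rename fun j : ℕ+ => 2 * j

/-- The substitution `t_{2j} ↦ 0` (the variables of odd index are kept). -/
def killEven : V →ₐ[ℚ] V :=
  MvPolynomial.aeval fun j : ℕ+ => if Even (j : ℕ) then (0 : V) else MvPolynomial.X j

/-! ## Irreducible characters of the symmetric group and Schur functions -/

/-- The group algebra of the symmetric group `S_n` over `ℚ`. -/
abbrev GroupAlg (n : ℕ) : Type := MonoidAlgebra ℚ (Equiv.Perm (Fin n))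

/-- The parts of a partition in weakly decreasing order. -/
def rowLengths {n : ℕ} (lam : n.Partition) : List ℕ := lam.parts.sort (· ≥ ·)

/-- The position (row, column), counted from `0`, of the entry `k` in the tableau with the given
row lengths that is filled with `0, 1, 2, …` row by row, from left to right. -/
def cell : List ℕ → ℕ → ℕ × ℕ
  | [], _ => (0, 0)
  | a :: l, k => if k < a then (0, k) else ((cell l (k - a)).1 + 1, (cell l (k - a)).2)

/-- The Young symmetrizer `c_λ = (∑_{σ ∈ R} σ) (∑_{σ ∈ C} sgn(σ) σ)`, where `R` and `C` are the
groups of those permutations that preserve every row, respectively every column, of the tableau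
of shape `λ` filled row by row. -/
def youngSymmetrizer {n : ℕ} (lam : n.Partition) : GroupAlg n :=
  (∑ σ : {σ : Equiv.Perm (Fin n) //
      ∀ k, (cell (rowLengths lam) (σ k)).1 = (cell (rowLengths lam) k).1},
    MonoidAlgebra.of ℚ (Equiv.Perm (Fin n)) σ.1) *
  (∑ σ : {σ : Equiv.Perm (Fin n) //
      ∀ k, (cell (rowLengths lam) (σ k)).2 = (cell (rowLengths lam) k).2},
    ((Equiv.Perm.sign σ.1 : ℤ) : ℚ) • MonoidAlgebra.of ℚ (Equiv.Perm (Fin n)) σ.1)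

/-- The Specht module of `λ`: the left ideal `ℚ[S_n] c_λ`. -/
def specht {n : ℕ} (lam : n.Partition) : Ideal (GroupAlg n) :=
  Ideal.span {youngSymmetrizer lam}

/-- The irreducible character of `S_n` attached to `λ`: the trace of left multiplication by `σ`
on the Specht module. -/
def spechtCharacter {n : ℕ} (lam : n.Partition) (σ : Equiv.Perm (Fin n)) : ℚ :=
  LinearMap.trace ℚ (specht lam)
    (Algebra.lsmul ℚ ℚ (specht lam) (MonoidAlgebra.of ℚ (Equiv.Perm (Fin n)) σ))

theorem exists_perm_partition {n : ℕ} (ρ : n.Partition) :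
    ∃ σ : Equiv.Perm (Fin n), σ.partition.parts = ρ.parts := by
  have h : ∃ σ : Equiv.Perm (Fin n), σ.cycleType = ρ.parts.filter (2 ≤ ·) := by
    rw [Equiv.Perm.exists_with_cycleType_iff]
    refine ⟨?_, fun a ha => (Multiset.mem_filter.1 ha).2⟩
    have h1 := ρ.parts_sum
    rw [← Multiset.filter_add_not (2 ≤ ·) ρ.parts, Multiset.sum_add] at h1
    simp only [Fintype.card_fin]
    omega
  obtain ⟨σ, hσ⟩ := h
  refine ⟨σ, ?_⟩
  have e1 : ρ.parts.filter (¬ 2 ≤ ·) =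
      Multiset.replicate (ρ.parts.filter (¬ 2 ≤ ·)).card 1 := by
    rw [Multiset.eq_replicate_card]
    intro b hb
    obtain ⟨hb1, hb2⟩ := Multiset.mem_filter.1 hb
    have := ρ.parts_pos hb1
    omega
  have h1 := ρ.parts_sum
  rw [← Multiset.filter_add_not (2 ≤ ·) ρ.parts, Multiset.sum_add] at h1
  have e2 : (ρ.parts.filter (¬ 2 ≤ ·)).sum = (ρ.parts.filter (¬ 2 ≤ ·)).card := by
    conv_lhs => rw [e1]
    simp
  have e3 := σ.sum_cycleType
  rw [hσ] at e3
  have e4 : Fintype.card (Fin n) - σ.support.card = (ρ.parts.filter (¬ 2 ≤ ·)).card := by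
    rw [Fintype.card_fin]
    omega
  rw [Equiv.Perm.parts_partition, hσ, e4, ← e1, Multiset.filter_add_not]

/-- A permutation of cycle type `ρ`. -/
def classRep {n : ℕ} (ρ : n.Partition) : Equiv.Perm (Fin n) :=
  (exists_perm_partition ρ).choose

/-- The Schur function `S_λ(t) = ∑_ρ χ^λ_ρ t_1^{m_1} t_2^{m_2} ⋯ / (m_1! m_2! ⋯)`. -/
def schurS {n : ℕ} (lam : n.Partition) : V :=
  ∑ ρ : n.Partition, MvPolynomial.C (spechtCharacter lam (classRep ρ)) * tMonomial ρ

/-! ## Schur's Q-functions -/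

/-- `q_n(t)`, the coefficient of `z^n` in `exp (∑_{j odd} t_j z^j)`; the sum runs over the
partitions of `n` into odd parts. -/
def qOne (n : ℕ) : V := ∑ ρ ∈ Nat.Partition.odds n, tMonomial ρ

/-- `Q_{(a,b)} = q_a q_b + 2 ∑_{i=1}^{b} (-1)^i q_{a+i} q_{b-i}` (used for `a > b ≥ 0`). -/
def qTwo (a b : ℕ) : V :=
  qOne a * qOne b + 2 * ∑ i ∈ Finset.Icc 1 b, (-1) ^ i * (qOne (a + i) * qOne (b - i))

/-- The Pfaffian of the skew-symmetric matrix with entries `f (x_i) (x_j)`, `i < j`, where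
`x_0, x_1, …` are the members of the list, by expansion along the first row. -/
def pfaffian (f : ℕ → ℕ → V) : List ℕ → V
  | [] => 1
  | x :: l => ∑ i : Fin l.length, (-1) ^ (i : ℕ) * f x (l.get i) * pfaffian f (l.eraseIdx i)
termination_by l => l.length
decreasing_by
  have := i.isLt
  simp only [List.length_eraseIdx, List.length_cons]
  split <;> omega

/-- Schur's `Q`-function `Q_λ(t)` of a strict partition `λ = (λ_1 > λ_2 > ⋯)`: the Pfaffian of the
matrix `(Q_{(λ_i, λ_j)})`, where a part `0` is appended if the number of parts is odd. -/
def schurQ {n : ℕ} (lam : n.Partition) : V :=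
  if Even lam.parts.card then pfaffian qTwo (rowLengths lam)
  else pfaffian qTwo (rowLengths lam ++ [0])

/-! ## Maps between partitions -/

/-- The number of parts of a partition. -/
def len {n : ℕ} (lam : n.Partition) : ℕ := lam.parts.card

/-- The parts of `λ^r`: every `i` whose multiplicity in `λ` is odd, once. -/
def rParts {n : ℕ} (lam : n.Partition) : Multiset ℕ :=
  lam.parts.dedup.filter fun i => Odd (lam.parts.count i)

/-- The parts of `λ^d`: every `i` with multiplicity `⌊m_i(λ) / 2⌋`. -/
def dParts {n : ℕ} (lam : n.Partition) : Multiset ℕ :=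
  ∑ i ∈ lam.parts.toFinset, Multiset.replicate (lam.parts.count i / 2) i

/-- The strict partition `λ^r` of `n_0 = |λ^r|`. -/
def rPart {n : ℕ} (lam : n.Partition) : (rParts lam).sum.Partition where
  parts := rParts lam
  parts_pos hi := lam.parts_pos (Multiset.mem_dedup.1 (Multiset.mem_filter.1 hi).1)
  parts_sum := rfl

/-- The partition `λ^d` of `n_1 = |λ^d|`. -/
def dPart {n : ℕ} (lam : n.Partition) : (dParts lam).sum.Partition where
  parts := dParts lam
  parts_pos hi := by
    obtain ⟨j, hj, hij⟩ := Multiset.mem_sum.1 hi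
    rw [Multiset.eq_of_mem_replicate hij]
    exact lam.parts_pos (Multiset.mem_toFinset.1 hj)
  parts_sum := rfl

/-- The set `P(n_0, n_1)` of the partitions `λ` of `n` with `|λ^r| = n_0` and `|λ^d| = n_1`. -/
abbrev PairPart (n n₀ n₁ : ℕ) : Type :=
  {lam : n.Partition // (rParts lam).sum = n₀ ∧ (dParts lam).sum = n₁}

/-- The set `SP(n)` of the strict partitions of `n`. -/
abbrev StrictPart (n : ℕ) : Type := {lam : n.Partition // lam.parts.Nodup}

/-- The parts of the image of a partition under the 2-Glaisher map: a part `2^p q` with `q` odd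
contributes `2^p` parts `q`. -/
def glaisherParts {n : ℕ} (lam : n.Partition) : Multiset ℕ :=
  lam.parts.bind fun a => Multiset.replicate (2 ^ padicValNat 2 a) (a / 2 ^ padicValNat 2 a)

/-- The image of a (strict) partition of `n` under the 2-Glaisher map. -/
def glaisher {n : ℕ} (lam : n.Partition) : n.Partition where
  parts := glaisherParts lam
  parts_pos hi := by
    obtain ⟨a, ha, hia⟩ := Multiset.mem_bind.1 hi
    rw [Multiset.eq_of_mem_replicate hia]
    exact Nat.div_pos (Nat.le_of_dvd (lam.parts_pos ha) pow_padicValNat_dvd) (by positivity)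
  parts_sum := by
    have h : ∀ a : ℕ, 2 ^ padicValNat 2 a * (a / 2 ^ padicValNat 2 a) = a := fun a =>
      Nat.mul_div_cancel' pow_padicValNat_dvd
    simp [glaisherParts, Multiset.sum_bind, h, lam.parts_sum]

theorem rParts_sum_add {n : ℕ} (lam : n.Partition) :
    (rParts lam).sum + 2 * (dParts lam).sum = n := by
  have h1 : (rParts lam).sum =
      ∑ i ∈ lam.parts.toFinset, (lam.parts.count i % 2) * i := by
    have : (rParts lam).sum =
        ∑ i ∈ lam.parts.toFinset.filter (fun i => Odd (lam.parts.count i)), i := by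
      simp [rParts, Finset.sum, Multiset.toFinset]
    rw [this, Finset.sum_filter]
    refine Finset.sum_congr rfl fun i _ => ?_
    rcases Nat.mod_two_eq_zero_or_one (lam.parts.count i) with h | h <;>
      simp [h, Nat.odd_iff]
  have h2 : (dParts lam).sum = ∑ i ∈ lam.parts.toFinset, (lam.parts.count i / 2) * i := by
    simp [dParts, Multiset.sum_sum]
  have h3 : n = ∑ i ∈ lam.parts.toFinset, lam.parts.count i * i := by
    conv_lhs => rw [← lam.parts_sum, Finset.sum_multiset_count]
    simp
  rw [h1, h2, Finset.mul_sum, ← Finset.sum_add_distrib]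
  conv_rhs => rw [h3]
  refine Finset.sum_congr rfl fun i _ => ?_
  rw [← mul_assoc, ← add_mul, Nat.mod_add_div]

theorem dParts_sum_eq_zero_iff {n : ℕ} (lam : n.Partition) :
    (dParts lam).sum = 0 ↔ lam.parts.Nodup := by
  rw [Multiset.nodup_iff_count_le_one]
  have h2 : (dParts lam).sum = ∑ i ∈ lam.parts.toFinset, (lam.parts.count i / 2) * i := by
    simp [dParts, Multiset.sum_sum]
  rw [h2, Finset.sum_eq_zero_iff]
  constructor
  · intro h i
    by_cases hi : i ∈ lam.parts
    · have := lam.parts_pos hi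
      rcases Nat.mul_eq_zero.1 (h i (Multiset.mem_toFinset.2 hi)) with h' | h' <;> omega
    · simp [Multiset.count_eq_zero_of_notMem hi]
  · intro h i _
    have := h i
    rw [Nat.div_eq_of_lt (by omega), zero_mul]

/-- The identification `SP(n) = P(n, 0)`, `μ ↔ (μ, ∅)`. -/
def strictEquiv (n : ℕ) : StrictPart n ≃ PairPart n n 0 :=
  Equiv.subtypeEquivRight fun lam => by
    have h1 := rParts_sum_add lam
    have h2 := dParts_sum_eq_zero_iff lam
    constructor
    · intro h
      have := h2.2 h
      omega
    · exact fun h => h2.1 h.2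

/-! ## The compound basis and the transition matrix -/

/-- The compound basis element `W_λ(t) = Q_{λ^r}(t) S_{λ^d}(t')`, `t'_j = t_{2j}`. -/
def compoundW {n : ℕ} (lam : n.Partition) : V :=
  schurQ (rPart lam) * doubleVars (schurS (dPart lam))

/-- `A = (a_{λμ})` satisfies `S_λ(t) = ∑_μ a_{λμ} W_μ(t)` for all `λ ∈ P(n)`. -/
def IsTransitionMatrix {n : ℕ} (A : Matrix n.Partition n.Partition ℚ) : Prop :=
  ∀ lam : n.Partition, schurS lam = ∑ mu : n.Partition, A lam mu • compoundW mu

/-- The submatrix `Γ_n` of the columns `(μ, ∅)`, `μ ∈ SP(n)`. -/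
def stembridge {n : ℕ} (A : Matrix n.Partition n.Partition ℚ) :
    Matrix n.Partition (StrictPart n) ℚ :=
  A.submatrix id Subtype.val

/-- The diagonal block `B_{n_0,n_1}` of `ᵗA A`, with rows and columns in `P(n_0, n_1)`. -/
def block {n : ℕ} (A : Matrix n.Partition n.Partition ℚ) (n₀ n₁ : ℕ) :
    Matrix (PairPart n n₀ n₁) (PairPart n n₀ n₁) ℚ :=
  (Aᵀ * A).submatrix Subtype.val Subtype.val

end Compound

end

noncomputable section

namespace Compound

/-! ## Fillings of Young diagrams -/

/-! Give `V` the Hall form `pair hallWeight`, in which monomials are orthogonal and `t_j^m` has norm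
`m!/j^m`. The Schur functions of degree `n` are orthonormal, so `S = A W` gives `A · Gram(W) · ᵗA =
1`, that is, `ᵗA A = Gram(W)⁻¹` (`gramW_mul_eq_one`). The blocks and their determinants can
therefore be read off from `Gram(W)`. Since `Q_{λ^r}` involves only odd variables and `S_{λ^d}(t')`
only even ones, the pairing of two `W`s factors (`pair_mul_doubleVars`). Hence `Gram(W)` is block
diagonal, and its block at `(n₀, n₁)` is the Kronecker product of the Gram matrices of the `Q_μ` in
degree `n₀` and of the `S_ν(t')` with `ν` of size `n₁`.

Both determinants come from rescaling the form. On the `t_{2j}` the Hall weights are `1/(2j)`, so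
the Gram matrix of the `S_ν(t')` arises from the identity by inserting `2^{-ℓ(ρ)}` at `t^(ρ)`. For
the weights `2/j` the `Q_μ` are orthogonal with norms `2^{ℓ(μ)}` (`pair_listQ`); going back to `1/j`
divides the determinant by the product of `2^{ℓ(ρ)}` over odd `ρ`, which Glaisher's bijection
indexes by strict partitions (`det_gramQ`). As these determinants are nonzero, the `W_μ` form a
basis, so `A` exists and is unique. Setting `t_{2j} = 0` replaces `S_{λ^d}(t')` by its constant
term, which leaves the columns of `Γ`.

Two facts are proved from scratch. Orthonormality of the Schur functions: for idempotents `e`, `f`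
proportional to Young symmetrizers, `n!` times the trace of `x ↦ e x f` is the sum of the product of
the two characters (`card_mul_trace_twoSidedMul`), and the trace is `1` or `0`. Orthogonality of the
`Q`-functions: for the weights `2/j`, multiplication by `q_k` is adjoint to taking the coefficient
of `z^k` after `t_j ↦ t_j + (2/j) z^j`, `j` odd (`pair_qOne_mul`). This substitution perturbs the
Pfaffian by rank two, and the effect is the removal of one part (`pfBorder_rank_two`). -/

theorem card_column_filter_le {n : ℕ} {r c r' c' : Fin n → ℕ}
    (hlow : ∀ k, ∀ i < r k, ∃ k', r k' = i ∧ c k' = c k)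
    (hinj' : Function.Injective fun k => (r' k, c' k))
    (hc : ∀ j, (Finset.univ.filter fun k => c' k = j).card =
      (Finset.univ.filter fun k => c k = j).card) (i j : ℕ) :
    (Finset.univ.filter fun k => r' k < i ∧ c' k = j).card ≤
      (Finset.univ.filter fun k => r k < i ∧ c k = j).card := by
  -- If column `j` of the diagram reaches row `i`, it has a cell in each of the `i` rows above, and
  -- no filling has more. Otherwise the whole column lies above row `i`, and both columns have the
  -- same size.
  by_cases h : ∃ k, c k = j ∧ i ≤ r k
  · obtain ⟨k, hk, hik⟩ := h
    trans i
    · conv_rhs => rw [← Finset.card_range i]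
      refine Finset.card_le_card_of_injOn r' (fun x hx => ?_) fun x hx y hy hxy => ?_
      · simpa using (Finset.mem_filter.1 hx).2.1
      · refine hinj' (Prod.ext hxy ?_)
        dsimp only
        rw [(Finset.mem_filter.1 hx).2.2, (Finset.mem_filter.1 hy).2.2]
    · have : ∀ m : Fin i, ∃ k', r k' = m ∧ c k' = c k := fun m =>
        hlow k m (lt_of_lt_of_le m.2 hik)
      choose g hg1 hg2 using this
      conv_lhs => rw [← Fintype.card_fin i, ← Finset.card_univ]
      refine Finset.card_le_card_of_injOn g (fun x _ => ?_) fun x _ y _ hxy => ?_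
      · simp [hg1, hg2, hk]
      · rw [Fin.ext_iff, ← hg1, ← hg1, hxy]
  · push Not at h
    have e : (Finset.univ.filter fun k => r k < i ∧ c k = j) =
        Finset.univ.filter fun k => c k = j := by
      ext k
      simpa using fun hk => h k hk
    rw [e, ← hc j]
    exact Finset.card_le_card fun k hk => by
      simp only [Finset.mem_filter, Finset.mem_univ, true_and] at hk ⊢
      exact hk.2

theorem card_row_filter_eq_sum {n : ℕ} (r c : Fin n → ℕ) (i : ℕ) {J : Finset ℕ}
    (hJ : ∀ k, c k ∈ J) :
    (Finset.univ.filter fun k => r k < i).card =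
      ∑ j ∈ J, (Finset.univ.filter fun k => r k < i ∧ c k = j).card := by
  rw [Finset.card_eq_sum_card_fiberwise (f := c) (t := J) fun k _ => hJ k]
  simp only [Finset.filter_filter]

theorem card_row_filter_le {n : ℕ} {r c r' c' : Fin n → ℕ}
    (hlow : ∀ k, ∀ i < r k, ∃ k', r k' = i ∧ c k' = c k)
    (hinj' : Function.Injective fun k => (r' k, c' k))
    (hc : ∀ j, (Finset.univ.filter fun k => c' k = j).card =
      (Finset.univ.filter fun k => c k = j).card) (i : ℕ) :
    (Finset.univ.filter fun k => r' k < i).card ≤ (Finset.univ.filter fun k => r k < i).card := by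
  rw [card_row_filter_eq_sum r' c' i (J := Finset.univ.image c' ∪ Finset.univ.image c) (by simp),
    card_row_filter_eq_sum r c i (J := Finset.univ.image c' ∪ Finset.univ.image c) (by simp)]
  exact Finset.sum_le_sum fun j _ => card_column_filter_le hlow hinj' hc i j

/-- A filling with the same row and column marginals as a Young diagram has the same cells. -/
theorem exists_cell_eq {n : ℕ} {r c c' : Fin n → ℕ}
    (hlow : ∀ k, ∀ i < r k, ∃ k', r k' = i ∧ c k' = c k)
    (hinj' : Function.Injective fun k => (r k, c' k))
    (hc : ∀ j, (Finset.univ.filter fun k => c' k = j).card =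
      (Finset.univ.filter fun k => c k = j).card) (k : Fin n) :
    ∃ k', r k' = r k ∧ c k' = c' k := by
  -- Both fillings use the row function `r`, so the column inequalities add up to an equality and
  -- each of them is one.
  have key : ∀ i, (Finset.univ.filter fun x => r x < i ∧ c' x = c' k).card =
      (Finset.univ.filter fun x => r x < i ∧ c x = c' k).card := by
    intro i
    have h1 := card_row_filter_eq_sum r c' i
      (J := Finset.univ.image c' ∪ Finset.univ.image c) (by simp)
    rw [card_row_filter_eq_sum r c i
      (J := Finset.univ.image c' ∪ Finset.univ.image c) (by simp)] at h1
    exact (Finset.sum_eq_sum_iff_of_le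
      fun j _ => card_column_filter_le hlow hinj' hc i j).1 h1.symm (c' k) (by simp)
  -- If the cell were missing, the count for `c` would not change from `r k` to `r k + 1`, while `k`
  -- itself raises the count for `c'`.
  by_contra! hno
  have e : (Finset.univ.filter fun x => r x < r k + 1 ∧ c x = c' k) =
      Finset.univ.filter fun x => r x < r k ∧ c x = c' k := by
    ext x
    simp only [Finset.mem_filter, Finset.mem_univ, true_and]
    refine ⟨fun hx => ⟨lt_of_le_of_ne (Nat.lt_succ_iff.1 hx.1) fun h => hno x h hx.2, hx.2⟩,
      fun hx => ⟨hx.1.trans (Nat.lt_succ_self _), hx.2⟩⟩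
  have h1 := key (r k + 1)
  rw [e, ← key (r k)] at h1
  refine absurd h1 (Finset.card_lt_card ?_).ne'
  rw [Finset.ssubset_iff_of_subset]
  · exact ⟨k, by simp, by simp⟩
  · intro x hx
    simp only [Finset.mem_filter, Finset.mem_univ, true_and] at hx ⊢
    omega

/-! ### The standard filling of a diagram, row by row -/

theorem cell_snd_lt (l : List ℕ) {k : ℕ} (hk : k < l.sum) :
    (cell l k).2 < l.getD (cell l k).1 0 := by
  induction l generalizing k with
  | nil => simp at hk
  | cons a l ih =>
    rw [List.sum_cons] at hk
    simp only [cell]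
    split_ifs with h
    · simpa using h
    · simpa using ih (k := k - a) (by omega)

theorem cell_injOn (l : List ℕ) {k k' : ℕ} (hk : k < l.sum) (hk' : k' < l.sum)
    (h : cell l k = cell l k') : k = k' := by
  induction l generalizing k k' with
  | nil => simp at hk
  | cons a l ih =>
    rw [List.sum_cons] at hk hk'
    simp only [cell] at h
    split_ifs at h with h1 h2 h2
    · simpa using h
    · simp at h
    · simp at h
    · simp only [Prod.mk.injEq, Nat.add_right_cancel_iff] at h
      have := ih (k := k - a) (k' := k' - a) (by omega) (by omega) (Prod.ext h.1 h.2)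
      omega

theorem exists_cell (l : List ℕ) {i j : ℕ} (h : j < l.getD i 0) :
    ∃ k < l.sum, cell l k = (i, j) := by
  induction l generalizing i with
  | nil => simp at h
  | cons a l ih =>
    cases i with
    | zero =>
      have h : j < a := by simpa using h
      exact ⟨j, by rw [List.sum_cons]; omega, by simp [cell, h]⟩
    | succ i =>
      obtain ⟨k, hk, hc⟩ := ih (i := i) (by simpa using h)
      refine ⟨a + k, by rw [List.sum_cons]; omega, ?_⟩
      simp [cell, hc]

theorem sum_rowLengths {n : ℕ} (lam : n.Partition) : (rowLengths lam).sum = n := by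
  rw [← Multiset.sum_coe, rowLengths, Multiset.sort_eq, lam.parts_sum]

theorem pairwise_rowLengths {n : ℕ} (lam : n.Partition) :
    (rowLengths lam).Pairwise (· ≥ ·) := Multiset.pairwise_sort _ _

theorem pos_of_mem_rowLengths {n : ℕ} (lam : n.Partition) {a : ℕ} (h : a ∈ rowLengths lam) :
    0 < a := lam.parts_pos ((Multiset.mem_sort _).1 h)

theorem getD_le_getD {l : List ℕ} (hl : l.Pairwise (· ≥ ·)) {i j : ℕ} (hij : i ≤ j) :
    l.getD j 0 ≤ l.getD i 0 := by
  rcases hij.eq_or_lt with rfl | hij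
  · exact le_rfl
  by_cases hj : j < l.length
  · rw [List.getD_eq_getElem _ _ hj, List.getD_eq_getElem _ _ (hij.trans hj)]
    exact List.pairwise_iff_getElem.1 hl _ _ _ _ hij
  · rw [List.getD_eq_default _ _ (by omega)]
    exact Nat.zero_le _

/-- The row of an entry of the standard filling. -/
def rowOf {n : ℕ} (lam : n.Partition) (k : Fin n) : ℕ := (cell (rowLengths lam) k).1

/-- The column of an entry of the standard filling. -/
def colOf {n : ℕ} (lam : n.Partition) (k : Fin n) : ℕ := (cell (rowLengths lam) k).2

theorem rowOf_colOf_injective {n : ℕ} (lam : n.Partition) :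
    Function.Injective fun k => (rowOf lam k, colOf lam k) := fun k k' h =>
  Fin.ext (cell_injOn (rowLengths lam) (by rw [sum_rowLengths]; exact k.2)
    (by rw [sum_rowLengths]; exact k'.2) (Prod.ext (Prod.mk.inj h).1 (Prod.mk.inj h).2))

theorem exists_rowOf_colOf {n : ℕ} (lam : n.Partition) {i j : ℕ}
    (h : j < (rowLengths lam).getD i 0) : ∃ k, rowOf lam k = i ∧ colOf lam k = j := by
  obtain ⟨k, hk, hc⟩ := exists_cell _ h
  rw [sum_rowLengths] at hk
  exact ⟨⟨k, hk⟩, by simp [rowOf, hc], by simp [colOf, hc]⟩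

theorem colOf_lt {n : ℕ} (lam : n.Partition) (k : Fin n) :
    colOf lam k < (rowLengths lam).getD (rowOf lam k) 0 :=
  cell_snd_lt _ (by rw [sum_rowLengths]; exact k.2)

theorem rowOf_lower {n : ℕ} (lam : n.Partition) (k : Fin n) (i : ℕ) (hi : i < rowOf lam k) :
    ∃ k', rowOf lam k' = i ∧ colOf lam k' = colOf lam k :=
  exists_rowOf_colOf lam
    ((colOf_lt lam k).trans_le (getD_le_getD (pairwise_rowLengths lam) hi.le))

theorem card_rowOf_eq {n : ℕ} (lam : n.Partition) (i : ℕ) :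
    (Finset.univ.filter fun k => rowOf lam k = i).card = (rowLengths lam).getD i 0 := by
  conv_rhs => rw [← Finset.card_range ((rowLengths lam).getD i 0)]
  refine Finset.card_nbij (colOf lam) (fun k hk => ?_) (fun k hk k' hk' h => ?_) fun j hj => ?_
  · rw [Finset.coe_range, Set.mem_Iio]
    have := colOf_lt lam k
    rwa [(Finset.mem_filter.1 hk).2] at this
  · refine rowOf_colOf_injective lam (Prod.ext ?_ h)
    dsimp only
    rw [(Finset.mem_filter.1 hk).2, (Finset.mem_filter.1 hk').2]
  · obtain ⟨k, h1, h2⟩ := exists_rowOf_colOf lam (Finset.mem_range.1 (Finset.mem_coe.1 hj))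
    exact ⟨k, by simp [h1], h2⟩

theorem list_eq_of_getD_eq {l l' : List ℕ} (hl : ∀ a ∈ l, 0 < a) (hl' : ∀ a ∈ l', 0 < a)
    (h : ∀ i, l.getD i 0 = l'.getD i 0) : l = l' := by
  induction l generalizing l' with
  | nil =>
    cases l' with
    | nil => rfl
    | cons b l' =>
      have h0 := h 0
      have := hl' b (by simp)
      simp at h0
      omega
  | cons a l ih =>
    cases l' with
    | nil =>
      have h0 := h 0
      have := hl a (by simp)
      simp at h0
      omega
    | cons b l' =>
      have h0 := h 0
      simp only [List.getD_cons_zero] at h0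
      rw [h0, ih (l' := l') (fun x hx => hl x (by simp [hx])) (fun x hx => hl' x (by simp [hx]))
        fun i => by simpa using h (i + 1)]

/-- The counts are the partial sums of the row lengths, so their differences recover the rows. -/
theorem eq_of_card_rowOf_lt_eq {n : ℕ} {lam mu : n.Partition}
    (h : ∀ i, (Finset.univ.filter fun k => rowOf lam k < i).card =
      (Finset.univ.filter fun k => rowOf mu k < i).card) : lam = mu := by
  have hsucc : ∀ (nu : n.Partition) (i : ℕ),
      (Finset.univ.filter fun k => rowOf nu k < i + 1).card =
        (Finset.univ.filter fun k => rowOf nu k < i).card + (rowLengths nu).getD i 0 := by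
    intro nu i
    rw [← card_rowOf_eq, ← Finset.card_union_of_disjoint]
    · congr 1
      ext k
      simp
      omega
    · rw [Finset.disjoint_filter]
      intros
      omega
  have hl : rowLengths lam = rowLengths mu := by
    refine list_eq_of_getD_eq (fun a => pos_of_mem_rowLengths lam)
      (fun a => pos_of_mem_rowLengths mu) fun i => ?_
    have h1 := h (i + 1)
    rw [hsucc, hsucc, h i] at h1
    omega
  refine Nat.Partition.ext ?_
  rw [← Multiset.sort_eq lam.parts (· ≥ ·), ← Multiset.sort_eq mu.parts (· ≥ ·)]
  exact congrArg _ hl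

theorem card_comp_perm {n : ℕ} (c : Fin n → ℕ) (σ : Equiv.Perm (Fin n)) (j : ℕ) :
    (Finset.univ.filter fun k => c (σ k) = j).card =
      (Finset.univ.filter fun k => c k = j).card :=
  Finset.card_equiv σ (by simp)

/-- If no two entries of a row of `λ` are moved into one column of `μ`, then `μ` dominates `λ`. -/
theorem dominance_of_injective {n : ℕ} {lam mu : n.Partition} (σ : Equiv.Perm (Fin n))
    (h : Function.Injective fun k => (rowOf lam k, colOf mu (σ k))) (i : ℕ) :
    (Finset.univ.filter fun k => rowOf lam k < i).card ≤
      (Finset.univ.filter fun k => rowOf mu k < i).card :=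
  card_row_filter_le (c := colOf mu) (rowOf_lower mu) h (card_comp_perm _ σ) i

/-- A permutation that moves no two entries of a row into one column is a product of a column
preserving and a row preserving permutation. -/
theorem exists_row_col_factorization {n : ℕ} (lam : n.Partition) (σ : Equiv.Perm (Fin n))
    (h : Function.Injective fun k => (rowOf lam k, colOf lam (σ k))) :
    ∃ ρ γ : Equiv.Perm (Fin n), (∀ k, rowOf lam (ρ k) = rowOf lam k) ∧
      (∀ k, colOf lam (γ k) = colOf lam k) ∧ σ = γ * ρ := by
  have hex : ∀ k, ∃ k', rowOf lam k' = rowOf lam k ∧ colOf lam k' = colOf lam (σ k) :=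
    exists_cell_eq (rowOf_lower lam) h (card_comp_perm _ σ)
  -- `f k` is the entry in the row of `k` and the column of `σ k`. So `f` preserves rows and `σ f⁻¹`
  -- preserves columns.
  choose f hf1 hf2 using hex
  have hf : Function.Injective f := fun x y hxy => h <| by
    dsimp only
    rw [← hf1 x, ← hf2 x, ← hf1 y, ← hf2 y, hxy]
  let ρ := Equiv.ofBijective f (Finite.injective_iff_bijective.1 hf)
  refine ⟨ρ, σ * ρ⁻¹, hf1, fun k => ?_, by simp⟩
  obtain ⟨x, rfl⟩ := ρ.surjective k
  rw [Equiv.Perm.mul_apply, show ρ⁻¹ (ρ x) = x from ρ.symm_apply_apply x]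
  exact (hf2 x).symm

/-! ## Traces on a group algebra -/

section GroupAlgebra

variable {G : Type*} [Group G]

/-- The map `x ↦ a x b`. -/
def twoSidedMul (a b : MonoidAlgebra ℚ G) : MonoidAlgebra ℚ G →ₗ[ℚ] MonoidAlgebra ℚ G :=
  LinearMap.mulLeft ℚ a ∘ₗ LinearMap.mulRight ℚ b

theorem twoSidedMul_apply (a b x : MonoidAlgebra ℚ G) : twoSidedMul a b x = a * (x * b) := rfl

variable [Fintype G]

theorem trace_eq_sum_coeff (f : MonoidAlgebra ℚ G →ₗ[ℚ] MonoidAlgebra ℚ G) :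
    LinearMap.trace ℚ _ f = ∑ g, (f (MonoidAlgebra.of ℚ G g)).coeff g := by
  classical
  rw [LinearMap.trace_eq_matrix_trace ℚ (MonoidAlgebra.basis G ℚ), Matrix.trace]
  refine Finset.sum_congr rfl fun g _ => ?_
  rw [Matrix.diag_apply, LinearMap.toMatrix_apply, MonoidAlgebra.basis_apply]
  rfl

theorem finiteDimensional_monoidAlgebra {H : Type*} [Finite H] :
    Module.Finite ℚ (MonoidAlgebra ℚ H) :=
  Module.Finite.of_basis (MonoidAlgebra.basis H ℚ)

/-- The class function `σ ↦ tr (x ↦ σ x b)`. -/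
def traceChar (b : MonoidAlgebra ℚ G) (σ : G) : ℚ :=
  LinearMap.trace ℚ _ (twoSidedMul (MonoidAlgebra.of ℚ G σ) b)

theorem traceChar_eq_sum (b : MonoidAlgebra ℚ G) (σ : G) :
    traceChar b σ = ∑ g, b.coeff (g⁻¹ * σ⁻¹ * g) := by
  rw [traceChar, trace_eq_sum_coeff]
  refine Finset.sum_congr rfl fun g _ => ?_
  rw [twoSidedMul_apply, MonoidAlgebra.of_apply, MonoidAlgebra.of_apply,
    MonoidAlgebra.coeff_single_mul_apply, MonoidAlgebra.coeff_single_mul_apply]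
  simp [mul_assoc]

theorem traceChar_conj (b : MonoidAlgebra ℚ G) (σ τ : G) :
    traceChar b (τ * σ * τ⁻¹) = traceChar b σ := by
  rw [traceChar_eq_sum, traceChar_eq_sum]
  refine Fintype.sum_equiv (Equiv.mulLeft τ⁻¹) _ _ fun g => ?_
  simp [mul_assoc]

theorem traceChar_eq_of_isConj (b : MonoidAlgebra ℚ G) {σ τ : G} (h : IsConj σ τ) :
    traceChar b σ = traceChar b τ := by
  obtain ⟨c, rfl⟩ := isConj_iff.1 h
  rw [traceChar_conj]

theorem trace_twoSidedMul (a b : MonoidAlgebra ℚ G) :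
    LinearMap.trace ℚ _ (twoSidedMul a b) = ∑ h, a.coeff h * traceChar b h := by
  induction a using MonoidAlgebra.induction_linear with
  | zero =>
    have : twoSidedMul 0 b = 0 := by ext x; simp [twoSidedMul_apply]
    simp [this]
  | add x y hx hy =>
    have : twoSidedMul (x + y) b = twoSidedMul x b + twoSidedMul y b := by
      refine LinearMap.ext fun z => ?_
      simp [twoSidedMul_apply, add_mul]
    simp [this, hx, hy, add_mul, Finset.sum_add_distrib]
  | single g r =>
    have : twoSidedMul (MonoidAlgebra.single g r) b =
        r • twoSidedMul (MonoidAlgebra.of ℚ G g) b := by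
      refine LinearMap.ext fun z => ?_
      rw [LinearMap.smul_apply, twoSidedMul_apply, twoSidedMul_apply, ← smul_mul_assoc]
      simp
    rw [this, map_smul, Finset.sum_eq_single g]
    · simp [traceChar]
    · intro h _ hh
      simp [Finsupp.single_eq_of_ne hh]
    · simp

/-- The trace is unchanged when `a` is conjugated, because `traceChar b` is a class function;
averaging over conjugates turns the coefficients of `a` into `traceChar a`. For idempotents this is
the orthogonality relation of characters. -/
theorem card_mul_trace_twoSidedMul (a b : MonoidAlgebra ℚ G) :
    (Fintype.card G : ℚ) * LinearMap.trace ℚ _ (twoSidedMul a b) =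
      ∑ h, traceChar a h⁻¹ * traceChar b h := by
  simp_rw [traceChar_eq_sum a, inv_inv, Finset.sum_mul]
  rw [Finset.sum_comm]
  have : ∀ g : G, ∑ h, a.coeff (g⁻¹ * h * g) * traceChar b h =
      LinearMap.trace ℚ _ (twoSidedMul a b) := by
    intro g
    rw [trace_twoSidedMul]
    refine Fintype.sum_equiv (MulAut.conj g⁻¹).toEquiv _ _ fun h => ?_
    have := traceChar_conj b h g⁻¹
    simp only [inv_inv] at this
    simp [this]
  simp [this]

end GroupAlgebra

/-! ## Young symmetrizers -/

section Young

variable {n : ℕ}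

/-- The sum of the row preserving permutations. -/
def rowSum (lam : n.Partition) : GroupAlg n :=
  ∑ σ : {σ : Equiv.Perm (Fin n) //
      ∀ k, (cell (rowLengths lam) (σ k)).1 = (cell (rowLengths lam) k).1},
    MonoidAlgebra.of ℚ (Equiv.Perm (Fin n)) σ.1

/-- The signed sum of the column preserving permutations. -/
def colSum (lam : n.Partition) : GroupAlg n :=
  ∑ σ : {σ : Equiv.Perm (Fin n) //
      ∀ k, (cell (rowLengths lam) (σ k)).2 = (cell (rowLengths lam) k).2},
    ((Equiv.Perm.sign σ.1 : ℤ) : ℚ) • MonoidAlgebra.of ℚ (Equiv.Perm (Fin n)) σ.1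

theorem youngSymmetrizer_eq (lam : n.Partition) :
    youngSymmetrizer lam = rowSum lam * colSum lam := rfl

theorem rowSum_mul_of (lam : n.Partition) {τ : Equiv.Perm (Fin n)}
    (hτ : ∀ k, rowOf lam (τ k) = rowOf lam k) :
    rowSum lam * MonoidAlgebra.of ℚ _ τ = rowSum lam := by
  have hτ' : ∀ k, rowOf lam (τ⁻¹ k) = rowOf lam k := fun k => by
    rw [← hτ (τ⁻¹ k), show τ (τ⁻¹ k) = k from τ.apply_symm_apply k]
  rw [rowSum, Finset.sum_mul]
  refine Fintype.sum_equiv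
    ((Equiv.mulRight τ).subtypeEquiv fun σ => ⟨fun h k => ?_, fun h k => ?_⟩) _ _ fun σ => ?_
  · exact (h (τ k)).trans (hτ k)
  · have h1 := h (τ⁻¹ k)
    rw [Equiv.coe_mulRight, Equiv.Perm.mul_apply,
      show τ (τ⁻¹ k) = k from τ.apply_symm_apply k] at h1
    exact h1.trans (hτ' k)
  · rw [← map_mul]
    rfl

theorem of_mul_colSum (lam : n.Partition) {τ : Equiv.Perm (Fin n)}
    (hτ : ∀ k, colOf lam (τ k) = colOf lam k) :
    MonoidAlgebra.of ℚ _ τ * colSum lam = ((Equiv.Perm.sign τ : ℤ) : ℚ) • colSum lam := by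
  rw [colSum, Finset.mul_sum, Finset.smul_sum]
  refine Fintype.sum_equiv
    ((Equiv.mulLeft τ).subtypeEquiv fun σ => ⟨fun h k => ?_, fun h k => ?_⟩) _ _ fun σ => ?_
  · exact (hτ (σ k)).trans (h k)
  · exact (hτ (σ k)).symm.trans (h k)
  · rw [mul_smul_comm, ← map_mul, smul_smul]
    simp only [Equiv.subtypeEquiv_apply, Equiv.coe_mulLeft, map_mul, Units.val_mul, Int.cast_mul]
    rw [← mul_assoc, ← Int.cast_mul, ← Units.val_mul, Int.units_mul_self]
    simp

theorem apply_swap_of_eq {α β : Type*} [DecidableEq α] (f : α → β) {i j : α} (h : f i = f j)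
    (k : α) : f (Equiv.swap i j k) = f k := by
  rw [Equiv.swap_apply_def]
  split_ifs with h1 h2
  · rw [h1, h]
  · rw [h2, h]
  · rfl

/-- Two entries of one row are carried by `σ⁻¹` into one column. Their transposition is absorbed by
the row sum, and after passing `σ` it changes the sign of the column sum, so the product equals its
negative. -/
theorem rowSum_mul_of_mul_colSum_eq_zero (lam mu : n.Partition) (σ : Equiv.Perm (Fin n))
    (h : ¬ Function.Injective fun k => (rowOf lam k, colOf mu (σ⁻¹ k))) :
    rowSum lam * MonoidAlgebra.of ℚ _ σ * colSum mu = 0 := by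
  obtain ⟨i, j, hij, hne⟩ := Function.not_injective_iff.1 h
  obtain ⟨hr, hc⟩ := Prod.mk.inj hij
  set x := rowSum lam * MonoidAlgebra.of ℚ _ σ * colSum mu with hx
  have h1 : rowSum lam * MonoidAlgebra.of ℚ _ (Equiv.swap i j) = rowSum lam :=
    rowSum_mul_of lam (apply_swap_of_eq _ hr)
  have h2 : MonoidAlgebra.of ℚ _ (Equiv.swap (σ⁻¹ i) (σ⁻¹ j)) * colSum mu = - colSum mu := by
    rw [of_mul_colSum mu (apply_swap_of_eq _ hc),
      Equiv.Perm.sign_swap (fun h => hne (σ⁻¹.injective h))]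
    simp
  have h3 : Equiv.swap i j * σ = σ * Equiv.swap (σ⁻¹ i) (σ⁻¹ j) := by
    rw [Equiv.mul_swap_eq_swap_mul, show σ (σ⁻¹ i) = i from σ.apply_symm_apply i,
      show σ (σ⁻¹ j) = j from σ.apply_symm_apply j]
  have h4 : x = -x := by
    conv_lhs => rw [hx, ← h1, mul_assoc (rowSum lam), ← map_mul, h3, map_mul, ← mul_assoc,
      mul_assoc, h2, mul_neg]
  have h5 : (2 : ℚ) • x = 0 := by
    rw [two_smul]
    nth_rewrite 1 [h4]
    exact neg_add_cancel x
  simpa using (congrArg ((2 : ℚ)⁻¹ • ·) h5)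

/-- A nonzero product for a single permutation would force `mu` to dominate `lam`, by
`dominance_of_injective`. -/
theorem rowSum_mul_mul_colSum_eq_zero {lam mu : n.Partition} {i : ℕ}
    (h : (Finset.univ.filter fun k => rowOf mu k < i).card <
      (Finset.univ.filter fun k => rowOf lam k < i).card) (x : GroupAlg n) :
    rowSum lam * x * colSum mu = 0 := by
  induction x using MonoidAlgebra.induction_on with
  | of σ =>
    exact rowSum_mul_of_mul_colSum_eq_zero lam mu σ fun hinj =>
      (dominance_of_injective σ⁻¹ hinj i).not_gt h
  | add x y hx hy => rw [mul_add, add_mul, hx, hy, add_zero]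
  | smul r x hx => rw [mul_smul_comm, smul_mul_assoc, hx, smul_zero]

/-- For a permutation, either the product vanishes or the permutation is a row preserving one times
a column preserving one; the two sums absorb these factors up to sign. -/
theorem exists_rowSum_mul_mul_colSum (lam : n.Partition) (x : GroupAlg n) :
    ∃ r : ℚ, rowSum lam * x * colSum lam = r • youngSymmetrizer lam := by
  induction x using MonoidAlgebra.induction_on with
  | of σ =>
    by_cases h : Function.Injective fun k => (rowOf lam k, colOf lam (σ⁻¹ k))
    · obtain ⟨ρ, γ, hρ, hγ, hσ⟩ := exists_row_col_factorization lam σ⁻¹ h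
      have hρ' : ∀ k, rowOf lam (ρ⁻¹ k) = rowOf lam k := fun k => by
        rw [← hρ (ρ⁻¹ k), show ρ (ρ⁻¹ k) = k from ρ.apply_symm_apply k]
      have hγ' : ∀ k, colOf lam (γ⁻¹ k) = colOf lam k := fun k => by
        rw [← hγ (γ⁻¹ k), show γ (γ⁻¹ k) = k from γ.apply_symm_apply k]
      have : σ = ρ⁻¹ * γ⁻¹ := by rw [← inv_inv σ, hσ, mul_inv_rev]
      refine ⟨((Equiv.Perm.sign γ⁻¹ : ℤ) : ℚ), ?_⟩
      rw [this, map_mul, ← mul_assoc, rowSum_mul_of lam hρ', mul_assoc, of_mul_colSum lam hγ',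
        mul_smul_comm, youngSymmetrizer_eq]
    · exact ⟨0, by rw [rowSum_mul_of_mul_colSum_eq_zero lam lam σ h, zero_smul]⟩
  | add x y hx hy =>
    obtain ⟨r, hr⟩ := hx
    obtain ⟨s, hs⟩ := hy
    exact ⟨r + s, by rw [mul_add, add_mul, hr, hs, add_smul]⟩
  | smul q x hx =>
    obtain ⟨r, hr⟩ := hx
    exact ⟨q * r, by rw [mul_smul_comm, smul_mul_assoc, hr, smul_smul]⟩

theorem exists_youngSymmetrizer_mul_mul (lam : n.Partition) (x : GroupAlg n) :
    ∃ r : ℚ, youngSymmetrizer lam * x * youngSymmetrizer lam = r • youngSymmetrizer lam := by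
  obtain ⟨r, hr⟩ := exists_rowSum_mul_mul_colSum lam (colSum lam * x * rowSum lam)
  exact ⟨r, by rw [← hr, youngSymmetrizer_eq]; simp only [mul_assoc]⟩

/-- Only the identity preserves both rows and columns, so `1` arises from one pair of factors only.
-/
theorem coeff_one_youngSymmetrizer (lam : n.Partition) :
    (youngSymmetrizer lam).coeff 1 = 1 := by
  rw [youngSymmetrizer, Finset.sum_mul_sum, MonoidAlgebra.coeff_sum, Finsupp.finsetSum_apply,
    Finset.sum_eq_single ⟨1, fun _ => rfl⟩, MonoidAlgebra.coeff_sum, Finsupp.finsetSum_apply,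
    Finset.sum_eq_single ⟨1, fun _ => rfl⟩]
  · simp
  · intro γ _ hγ
    rw [mul_smul_comm, ← map_mul, MonoidAlgebra.coeff_smul_apply, MonoidAlgebra.of_apply,
      MonoidAlgebra.coeff_single, Finsupp.single_eq_of_ne, smul_zero]
    intro h
    refine hγ (Subtype.ext ?_)
    simpa using h.symm
  · simp
  · intro ρ _ hρ
    rw [MonoidAlgebra.coeff_sum, Finsupp.finsetSum_apply]
    refine Finset.sum_eq_zero fun γ _ => ?_
    rw [mul_smul_comm, ← map_mul, MonoidAlgebra.coeff_smul_apply, MonoidAlgebra.of_apply,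
      MonoidAlgebra.coeff_single, Finsupp.single_eq_of_ne, smul_zero]
    intro h
    refine hρ (Subtype.ext (Equiv.ext fun k => ?_))
    refine rowOf_colOf_injective lam (Prod.ext (ρ.2 k) ?_)
    have h1 := γ.2 (ρ.1 k)
    rw [show γ.1 = ρ.1⁻¹ from eq_inv_of_mul_eq_one_right h.symm,
      show ρ.1⁻¹ (ρ.1 k) = k from ρ.1.symm_apply_apply k] at h1
    exact h1.symm
  · simp

/-- If the scalar were zero, right multiplication by the symmetrizer would be nilpotent, of trace
`0`; but its trace is `n!` times the coefficient at `1`, that is, `n!`. -/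
theorem exists_youngSymmetrizer_sq (lam : n.Partition) :
    ∃ r : ℚ, r ≠ 0 ∧ youngSymmetrizer lam * youngSymmetrizer lam = r • youngSymmetrizer lam := by
  obtain ⟨r, hr⟩ := exists_youngSymmetrizer_mul_mul lam 1
  rw [mul_one] at hr
  refine ⟨r, ?_, hr⟩
  rintro rfl
  have htr : traceChar (youngSymmetrizer lam) 1 = (Fintype.card (Equiv.Perm (Fin n)) : ℚ) := by
    rw [traceChar_eq_sum]
    simp [coeff_one_youngSymmetrizer]
  have hnil : IsNilpotent (twoSidedMul (MonoidAlgebra.of ℚ _ 1) (youngSymmetrizer lam)) := by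
    refine ⟨2, LinearMap.ext fun x => ?_⟩
    rw [pow_two, Module.End.mul_apply, twoSidedMul_apply, twoSidedMul_apply, map_one, one_mul,
      one_mul, mul_assoc, hr]
    simp
  have := finiteDimensional_monoidAlgebra (H := Equiv.Perm (Fin n))
  have h0 := (LinearMap.isNilpotent_trace_of_isNilpotent hnil).eq_zero
  rw [traceChar, h0] at htr
  exact Fintype.card_ne_zero (α := Equiv.Perm (Fin n)) (by exact_mod_cast htr.symm)

/-- The primitive idempotent proportional to the Young symmetrizer. -/
theorem exists_idempotent (lam : n.Partition) :
    ∃ (r : ℚ) (e : GroupAlg n), r ≠ 0 ∧ e = r • youngSymmetrizer lam ∧ e * e = e := by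
  obtain ⟨r, hr, h⟩ := exists_youngSymmetrizer_sq lam
  refine ⟨r⁻¹, r⁻¹ • youngSymmetrizer lam, inv_ne_zero hr, rfl, ?_⟩
  rw [smul_mul_smul_comm, h, smul_smul, mul_assoc, inv_mul_cancel₀ hr, mul_one]

/-- The map `x ↦ σ x e` sends the whole group algebra into the Specht module, and there it is left
multiplication by `σ`, since `e` acts as a right identity. Restricting to a subspace that contains
the image keeps the trace. -/
theorem spechtCharacter_eq_traceChar {lam : n.Partition} {r : ℚ} {e : GroupAlg n} (hr : r ≠ 0)
    (he : e = r • youngSymmetrizer lam) (hee : e * e = e) (σ : Equiv.Perm (Fin n)) :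
    spechtCharacter lam σ = traceChar e σ := by
  have := finiteDimensional_monoidAlgebra (H := Equiv.Perm (Fin n))
  let p : Submodule ℚ (GroupAlg n) := (specht lam).restrictScalars ℚ
  have hmem : ∀ x, x * e ∈ specht lam := fun x => by
    rw [he, mul_smul_comm, ← smul_mul_assoc]
    exact Ideal.mul_mem_left _ _ (Ideal.mem_span_singleton_self _)
  have hfix : ∀ x ∈ specht lam, x * e = x := by
    intro x hx
    obtain ⟨y, rfl⟩ := Ideal.mem_span_singleton'.1 hx
    have : youngSymmetrizer lam = r⁻¹ • e := by
      rw [he, smul_smul, inv_mul_cancel₀ hr, one_smul]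
    rw [this, mul_assoc, smul_mul_assoc, hee]
  have hrange : ∀ x, twoSidedMul (MonoidAlgebra.of ℚ _ σ) e x ∈ p := fun x =>
    Ideal.mul_mem_left _ _ (hmem x)
  have := LinearMap.trace_restrict_eq_of_forall_mem p _ hrange
  rw [traceChar, ← this, spechtCharacter]
  change LinearMap.trace ℚ p _ = LinearMap.trace ℚ p _
  congr 1
  refine LinearMap.ext fun x => Subtype.ext ?_
  change MonoidAlgebra.of ℚ _ σ * x.1 = MonoidAlgebra.of ℚ _ σ * (x.1 * e)
  rw [hfix x.1 x.2]

theorem spechtCharacter_eq_of_isConj (lam : n.Partition) {σ τ : Equiv.Perm (Fin n)}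
    (h : IsConj σ τ) : spechtCharacter lam σ = spechtCharacter lam τ := by
  obtain ⟨r, e, hr, he, hee⟩ := exists_idempotent lam
  rw [spechtCharacter_eq_traceChar hr he hee, spechtCharacter_eq_traceChar hr he hee,
    traceChar_eq_of_isConj e h]

theorem isConj_inv_perm (σ : Equiv.Perm (Fin n)) : IsConj σ⁻¹ σ := by
  rw [Equiv.Perm.isConj_iff_cycleType_eq, Equiv.Perm.cycleType_inv]

theorem sum_spechtCharacter_mul_self (lam : n.Partition) :
    ∑ σ, spechtCharacter lam σ * spechtCharacter lam σ = (n.factorial : ℚ) := by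
  have := finiteDimensional_monoidAlgebra (H := Equiv.Perm (Fin n))
  obtain ⟨r, e, hr, he, hee⟩ := exists_idempotent lam
  have h := card_mul_trace_twoSidedMul e e
  have hne : e ≠ 0 := by
    rintro rfl
    have := coeff_one_youngSymmetrizer lam
    rw [(smul_eq_zero.1 he.symm).resolve_left hr] at this
    simp at this
  -- `x ↦ e x e` is a projection onto the line spanned by `e`.
  have htr : LinearMap.trace ℚ _ (twoSidedMul e e) = 1 := by
    have hp : LinearMap.IsProj (Submodule.span ℚ {e}) (twoSidedMul e e) := by
      refine ⟨fun x => ?_, fun x hx => ?_⟩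
      · obtain ⟨s, hs⟩ := exists_youngSymmetrizer_mul_mul lam x
        refine Submodule.mem_span_singleton.2 ⟨r * s, ?_⟩
        rw [twoSidedMul_apply, ← mul_assoc]
        nth_rewrite 2 [he]
        nth_rewrite 2 [he]
        rw [smul_mul_assoc, smul_mul_assoc, mul_smul_comm, hs, he]
        simp only [smul_smul]
        congr 1
        ring
      · obtain ⟨s, rfl⟩ := Submodule.mem_span_singleton.1 hx
        rw [twoSidedMul_apply, smul_mul_assoc, hee, mul_smul_comm, hee]
    rw [hp.trace, finrank_span_singleton hne, Nat.cast_one]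
  rw [htr, mul_one, Fintype.card_perm, Fintype.card_fin] at h
  rw [h]
  refine Finset.sum_congr rfl fun σ _ => ?_
  rw [spechtCharacter_eq_traceChar hr he hee, traceChar_eq_of_isConj e (isConj_inv_perm σ)]

theorem sum_spechtCharacter_mul_of_lt {lam mu : n.Partition} {i : ℕ}
    (h : (Finset.univ.filter fun k => rowOf mu k < i).card <
      (Finset.univ.filter fun k => rowOf lam k < i).card) :
    ∑ σ, spechtCharacter lam σ * spechtCharacter mu σ = 0 := by
  obtain ⟨r, e, hr, he, hee⟩ := exists_idempotent lam
  obtain ⟨s, f, hs, hf, hff⟩ := exists_idempotent mu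
  have h1 := card_mul_trace_twoSidedMul e f
  have h2 : twoSidedMul e f = 0 := by
    refine LinearMap.ext fun x => ?_
    have h3 := rowSum_mul_mul_colSum_eq_zero h (colSum lam * x * rowSum mu)
    have h4 : youngSymmetrizer lam * (x * youngSymmetrizer mu) = 0 := by
      rw [← h3, youngSymmetrizer_eq, youngSymmetrizer_eq]
      simp only [mul_assoc]
    rw [twoSidedMul_apply, he, hf, smul_mul_assoc, mul_smul_comm, mul_smul_comm, h4]
    simp
  rw [h2, map_zero, mul_zero] at h1
  rw [h1]
  refine Finset.sum_congr rfl fun σ _ => ?_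
  rw [spechtCharacter_eq_traceChar hr he hee, spechtCharacter_eq_traceChar hs hf hff,
    traceChar_eq_of_isConj e (isConj_inv_perm σ)]

theorem sum_spechtCharacter_mul (lam mu : n.Partition) :
    ∑ σ, spechtCharacter lam σ * spechtCharacter mu σ =
      if lam = mu then (n.factorial : ℚ) else 0 := by
  split_ifs with h
  · rw [h, sum_spechtCharacter_mul_self]
  -- Dominance is only a partial order, but one unequal partial sum is enough, in either direction.
  · have : ∃ i, (Finset.univ.filter fun k => rowOf lam k < i).card ≠
        (Finset.univ.filter fun k => rowOf mu k < i).card := by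
      by_contra! hall
      exact h (eq_of_card_rowOf_lt_eq hall)
    obtain ⟨i, hi⟩ := this
    rcases hi.lt_or_gt with hi | hi
    · simp_rw [mul_comm (spechtCharacter lam _)]
      exact sum_spechtCharacter_mul_of_lt hi
    · exact sum_spechtCharacter_mul_of_lt hi

end Young

/-! ## Exponents of partitions -/

section Exponents

variable {n : ℕ}

/-- The exponent of the monomial `t^(ρ)`. -/
def pexp (ρ : n.Partition) : ℕ+ →₀ ℕ :=
  ∑ i ∈ Finset.range n, Finsupp.single i.succPNat (ρ.parts.count (i + 1))

theorem le_of_mem_parts (ρ : n.Partition) {a : ℕ} (h : a ∈ ρ.parts) : a ≤ n := by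
  have := Multiset.single_le_sum (fun x _ => Nat.zero_le x) a h
  rwa [ρ.parts_sum] at this

theorem pexp_apply (ρ : n.Partition) (j : ℕ+) : pexp ρ j = ρ.parts.count (j : ℕ) := by
  rw [pexp, Finsupp.finsetSum_apply]
  by_cases hj : (j : ℕ) ≤ n
  · rw [Finset.sum_eq_single j.natPred]
    · simp [PNat.natPred_add_one]
    · intro i _ hi
      refine Finsupp.single_eq_of_ne fun h => hi ?_
      rw [h, Nat.natPred_succPNat]
    · intro h
      have := j.natPred_add_one
      exact absurd (Finset.mem_range.2 (by omega)) h
  · rw [Multiset.count_eq_zero_of_notMem fun h => hj (le_of_mem_parts ρ h)]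
    refine Finset.sum_eq_zero fun i hi => Finsupp.single_eq_of_ne fun h => hj ?_
    rw [h]
    simpa using Finset.mem_range.1 hi

theorem pexp_prod {M : Type*} [CommMonoid M] (ρ : n.Partition) (f : ℕ+ → ℕ → M)
    (hf : ∀ j, f j 0 = 1) :
    (pexp ρ).prod f = ∏ i ∈ Finset.range n, f i.succPNat (ρ.parts.count (i + 1)) := by
  rw [Finsupp.prod_of_support_subset (s := (Finset.range n).image Nat.succPNat)]
  · rw [Finset.prod_image fun a _ b _ h => Nat.succPNat_injective h]
    simp [pexp_apply]
  · intro j hj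
    rw [Finsupp.mem_support_iff, pexp_apply, ← Nat.pos_iff_ne_zero, Multiset.count_pos] at hj
    have h1 := le_of_mem_parts ρ hj
    have := j.natPred_add_one
    exact Finset.mem_image.2 ⟨j.natPred, Finset.mem_range.2 (by omega), by simp⟩
  · exact fun j _ => hf j

theorem pexp_sum {M : Type*} [AddCommMonoid M] (ρ : n.Partition) (f : ℕ+ → ℕ → M)
    (hf : ∀ j, f j 0 = 0) :
    (pexp ρ).sum f = ∑ i ∈ Finset.range n, f i.succPNat (ρ.parts.count (i + 1)) :=
  pexp_prod (M := Multiplicative M) ρ f hf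

/-- The weighted degree of an exponent. -/
def wdeg (d : ℕ+ →₀ ℕ) : ℕ := d.sum fun j m => m * j

theorem wdeg_add (d e : ℕ+ →₀ ℕ) : wdeg (d + e) = wdeg d + wdeg e :=
  Finsupp.sum_add_index' (by simp) (by simp [add_mul])

theorem prod_toFinset_eq_prod_range {M : Type*} [CommMonoid M] (s : Multiset ℕ) (N : ℕ)
    (h : ∀ a ∈ s, 0 < a ∧ a ≤ N) (f : ℕ → M) (hf : ∀ a, a ∉ s → f a = 1) :
    ∏ a ∈ s.toFinset, f a = ∏ i ∈ Finset.range N, f (i + 1) := by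
  rw [← Finset.prod_subset (s₁ := s.toFinset.image (· - 1)) (s₂ := Finset.range N)
    (f := fun i => f (i + 1))]
  · rw [Finset.prod_image]
    · refine Finset.prod_congr rfl fun a ha => ?_
      rw [Nat.sub_add_cancel (h a (Multiset.mem_toFinset.1 ha)).1]
    · intro a ha b hb hab
      have h1 := (h a (Multiset.mem_toFinset.1 ha)).1
      have h2 := (h b (Multiset.mem_toFinset.1 hb)).1
      dsimp only at hab
      omega
  · intro i hi
    obtain ⟨a, ha, rfl⟩ := Finset.mem_image.1 hi
    have := h a (Multiset.mem_toFinset.1 ha)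
    rw [Finset.mem_range]
    omega
  · intro i _ hi
    exact hf _ fun h' => hi (Finset.mem_image.2 ⟨i + 1, Multiset.mem_toFinset.2 h', by simp⟩)

theorem sum_range_count (s : Multiset ℕ) (N : ℕ) (h : ∀ a ∈ s, 0 < a ∧ a ≤ N) (f : ℕ → ℕ) :
    ∑ i ∈ Finset.range N, s.count (i + 1) * f (i + 1) = (s.map f).sum := by
  rw [Finset.sum_multiset_map_count]
  refine (prod_toFinset_eq_prod_range (M := Multiplicative ℕ) s N h
    (fun a => Multiplicative.ofAdd (s.count a * f a)) fun a ha => ?_).symm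
  simp [Multiset.count_eq_zero_of_notMem ha]

theorem wdeg_pexp (ρ : n.Partition) : wdeg (pexp ρ) = n := by
  rw [wdeg, pexp_sum _ _ (by simp)]
  simpa [ρ.parts_sum] using sum_range_count ρ.parts n
    (fun a ha => ⟨ρ.parts_pos ha, le_of_mem_parts ρ ha⟩) id

theorem card_eq_sum_pexp (ρ : n.Partition) :
    ρ.parts.card = ∑ i ∈ Finset.range n, ρ.parts.count (i + 1) := by
  simpa using (sum_range_count ρ.parts n
    (fun a ha => ⟨ρ.parts_pos ha, le_of_mem_parts ρ ha⟩) fun _ => 1).symm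

theorem pexp_eq_iff {m : ℕ} (ρ : n.Partition) (σ : m.Partition) :
    pexp ρ = pexp σ ↔ ρ.parts = σ.parts := by
  constructor
  · intro h
    refine Multiset.ext.2 fun a => ?_
    rcases Nat.eq_zero_or_pos a with rfl | ha
    · rw [Multiset.count_eq_zero_of_notMem fun h' => (ρ.parts_pos h').ne rfl,
        Multiset.count_eq_zero_of_notMem fun h' => (σ.parts_pos h').ne rfl]
    · exact (pexp_apply ρ ⟨a, ha⟩).symm.trans
        ((DFunLike.congr_fun h (⟨a, ha⟩ : ℕ+)).trans (pexp_apply σ ⟨a, ha⟩))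
  · intro h
    ext j
    rw [pexp_apply, pexp_apply, h]

theorem pexp_injective : Function.Injective (pexp (n := n)) := fun ρ σ h =>
  Nat.Partition.ext ((pexp_eq_iff ρ σ).1 h)

theorem exists_pexp_eq (d : ℕ+ →₀ ℕ) : ∃ ρ : (wdeg d).Partition, pexp ρ = d := by
  refine ⟨⟨(Finsupp.toMultiset d).map PNat.val, fun hi => ?_, ?_⟩, ?_⟩
  · obtain ⟨j, -, rfl⟩ := Multiset.mem_map.1 hi
    exact j.2
  · rw [wdeg, Finsupp.toMultiset_apply, Finsupp.sum, Finsupp.sum, ← Multiset.coe_mapAddMonoidHom,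
      map_sum, Multiset.sum_sum]
    simp [Multiset.map_nsmul, Multiset.sum_nsmul]
  · ext j
    rw [pexp_apply]
    dsimp only
    rw [Multiset.count_map_eq_count' _ _ PNat.coe_injective, Finsupp.count_toMultiset]

theorem exists_pexp_eq_of_wdeg {d : ℕ+ →₀ ℕ} (h : wdeg d = n) :
    ∃ ρ : n.Partition, pexp ρ = d := by
  subst h
  exact exists_pexp_eq d

theorem tMonomial_eq (ρ : n.Partition) :
    tMonomial ρ = MvPolynomial.monomial (pexp ρ)
      ((pexp ρ).prod fun _ m => ((m.factorial : ℚ))⁻¹) := by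
  rw [MvPolynomial.monomial_eq, pexp_prod _ _ (by simp), pexp_prod _ _ (by simp), map_prod,
    ← Finset.prod_mul_distrib]
  rfl

end Exponents

/-! ## Diagonal forms on `V` -/

section Form

/-- The squared norm of a monomial. -/
def wnorm (w : ℕ+ → ℚ) (d : ℕ+ →₀ ℕ) : ℚ := d.prod fun j m => (m.factorial : ℚ) * w j ^ m

/-- The form for which the monomials are orthogonal and `⟨t_j^m, t_j^m⟩ = m! w_j^m`. -/
def pair (w : ℕ+ → ℚ) : V →ₗ[ℚ] V →ₗ[ℚ] ℚ :=
  (MvPolynomial.basisMonomials ℕ+ ℚ).constr ℚ fun d => wnorm w d • MvPolynomial.lcoeff ℚ d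

theorem pair_monomial (w : ℕ+ → ℚ) (d : ℕ+ →₀ ℕ) (a : ℚ) (g : V) :
    pair w (MvPolynomial.monomial d a) g = a * (wnorm w d * g.coeff d) := by
  have : MvPolynomial.monomial d a = a • MvPolynomial.basisMonomials ℕ+ ℚ d := by
    simp [MvPolynomial.smul_monomial]
  rw [this, map_smul, pair, Module.Basis.constr_basis]
  rfl

theorem pair_monomial_monomial (w : ℕ+ → ℚ) (d e : ℕ+ →₀ ℕ) (a b : ℚ) :
    pair w (MvPolynomial.monomial d a) (MvPolynomial.monomial e b) =
      if d = e then a * b * wnorm w d else 0 := by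
  rw [pair_monomial, MvPolynomial.coeff_monomial]
  split_ifs with h1 h2 h2
  · ring
  · exact absurd h1.symm h2
  · exact absurd h2.symm h1
  · ring

theorem pair_comm (w : ℕ+ → ℚ) (f g : V) : pair w f g = pair w g f := by
  induction f using MvPolynomial.induction_on' with
  | monomial d a =>
    induction g using MvPolynomial.induction_on' with
    | monomial e b =>
      rw [pair_monomial_monomial, pair_monomial_monomial]
      split_ifs with h1 h2 h2
      · rw [h1]; ring
      · exact absurd h1.symm h2
      · exact absurd h2.symm h1
      · rfl
    | add p q hp hq => rw [map_add, hp, hq, map_add, LinearMap.add_apply]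
  | add p q hp hq => rw [map_add, LinearMap.add_apply, hp, hq, map_add]

theorem prod_inv_factorial_sq_mul_wnorm (w : ℕ+ → ℚ) (d : ℕ+ →₀ ℕ) :
    (d.prod fun _ m => ((m.factorial : ℚ))⁻¹) * (d.prod fun _ m => ((m.factorial : ℚ))⁻¹) *
      wnorm w d = d.prod fun j m => w j ^ m / m.factorial := by
  rw [wnorm, ← Finsupp.prod_mul, ← Finsupp.prod_mul]
  refine Finsupp.prod_congr fun j _ => ?_
  have : ((d j).factorial : ℚ) ≠ 0 := by positivity
  field_simp

/-- The inverse of `z_ρ`, with weights. -/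
def zinv {n : ℕ} (w : ℕ+ → ℚ) (ρ : n.Partition) : ℚ :=
  (pexp ρ).prod fun j m => w j ^ m / m.factorial

theorem pair_tMonomial {n : ℕ} (w : ℕ+ → ℚ) (ρ σ : n.Partition) :
    pair w (tMonomial ρ) (tMonomial σ) = if ρ = σ then zinv w ρ else 0 := by
  rw [tMonomial_eq, tMonomial_eq, pair_monomial_monomial]
  by_cases h : ρ = σ
  · rw [if_pos h, if_pos (by rw [h]), ← h, prod_inv_factorial_sq_mul_wnorm, zinv]
  · rw [if_neg h, if_neg fun h' => h (pexp_injective h')]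

end Form

/-! ## Orthonormality of the Schur functions -/

section Orthonormal

variable {n : ℕ}

/-- The cycle type of a permutation, fixed points included, as a partition of `n`. -/
def cyclePartition (σ : Equiv.Perm (Fin n)) : n.Partition where
  parts := σ.partition.parts
  parts_pos := σ.partition.parts_pos
  parts_sum := by rw [σ.partition.parts_sum, Fintype.card_fin]

theorem isConj_iff_cyclePartition_eq {σ τ : Equiv.Perm (Fin n)} :
    IsConj σ τ ↔ cyclePartition σ = cyclePartition τ := by
  rw [Equiv.Perm.partition_eq_of_isConj]
  rw [Nat.Partition.ext_iff, Nat.Partition.ext_iff]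
  rfl

theorem cyclePartition_classRep (ρ : n.Partition) : cyclePartition (classRep ρ) = ρ :=
  Nat.Partition.ext (exists_perm_partition ρ).choose_spec

theorem cycleType_classRep (ρ : n.Partition) :
    (classRep ρ).cycleType = ρ.parts.filter (2 ≤ ·) := by
  conv_rhs => rw [← cyclePartition_classRep ρ]
  rw [cyclePartition, Equiv.Perm.parts_partition, Multiset.filter_add,
    Multiset.filter_eq_self.2 fun a => Equiv.Perm.two_le_of_mem_cycleType,
    Multiset.filter_eq_nil.2, add_zero]
  intro a ha
  rw [Multiset.eq_of_mem_replicate ha]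
  decide

theorem card_cyclePartition_eq (ρ : n.Partition) :
    ((Finset.univ.filter fun σ => cyclePartition σ = ρ).card : ℚ) =
      n.factorial * zinv (fun j => ((j : ℕ) : ℚ)⁻¹) ρ := by
  have h1 : (Finset.univ.filter fun σ => cyclePartition σ = ρ) =
      Finset.univ.filter fun σ : Equiv.Perm (Fin n) =>
        σ.cycleType = ρ.parts.filter (2 ≤ ·) := by
    ext σ
    rw [Finset.mem_filter, Finset.mem_filter, ← cycleType_classRep,
      ← Equiv.Perm.isConj_iff_cycleType_eq, isConj_iff_cyclePartition_eq, cyclePartition_classRep]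
  have h2 := Equiv.Perm.card_of_cycleType_mul_eq (Fin n) (ρ.parts.filter (2 ≤ ·))
  rw [← h1, if_pos (by
    rw [← Equiv.Perm.exists_with_cycleType_iff]; exact ⟨_, cycleType_classRep ρ⟩)] at h2
  -- `cycleType` leaves out fixed points: the first factor is the `m_1!` of `z_ρ`, and the parts `1`
  -- contribute nothing to the product of the parts.
  have h3 : (Fintype.card (Fin n) - (ρ.parts.filter (2 ≤ ·)).sum).factorial *
      (ρ.parts.filter (2 ≤ ·)).prod *
      (∏ a ∈ (ρ.parts.filter (2 ≤ ·)).toFinset, ((ρ.parts.filter (2 ≤ ·)).count a).factorial) =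
      ∏ i ∈ Finset.range n, (i + 1) ^ ρ.parts.count (i + 1) *
        (ρ.parts.count (i + 1)).factorial := by
    set s := ρ.parts.filter (2 ≤ ·) with hs
    have hs1 : ∀ a ∈ s, 0 < a ∧ a ≤ n := fun a ha =>
      ⟨by have := (Multiset.mem_filter.1 ha).2; omega,
        le_of_mem_parts ρ (Multiset.mem_filter.1 ha).1⟩
    have hc1 : s.count 1 = 0 := by simp [hs]
    have hc2 : ∀ i, s.count (i + 1 + 1) = ρ.parts.count (i + 1 + 1) := fun i => by
      rw [hs, Multiset.count_filter_of_pos (by omega)]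
    have e1 := sum_range_count s n hs1 id
    have e2 := sum_range_count ρ.parts n
      (fun a ha => ⟨ρ.parts_pos ha, le_of_mem_parts ρ ha⟩) id
    rw [Multiset.map_id] at e1 e2
    rw [ρ.parts_sum] at e2
    rw [mul_assoc, Finset.prod_multiset_count, ← Finset.prod_mul_distrib,
      prod_toFinset_eq_prod_range s n hs1 _ fun a ha => by
        simp [Multiset.count_eq_zero_of_notMem ha], Fintype.card_fin]
    cases n with
    | zero => simp
    | succ m =>
      rw [Finset.sum_range_succ'] at e1 e2
      rw [Finset.prod_range_succ', Finset.prod_range_succ']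
      simp only [hc2, zero_add, hc1, id, add_zero, mul_one] at e1 e2 ⊢
      rw [show m + 1 - s.sum = ρ.parts.count 1 by omega]
      simp [mul_comm]
  rw [h3, Fintype.card_fin] at h2
  have h4 : zinv (fun j => ((j : ℕ) : ℚ)⁻¹) ρ =
      ((∏ i ∈ Finset.range n, (i + 1) ^ ρ.parts.count (i + 1) *
        (ρ.parts.count (i + 1)).factorial : ℕ) : ℚ)⁻¹ := by
    rw [zinv, pexp_prod _ _ (by simp), Nat.cast_prod, ← Finset.prod_inv_distrib]
    refine Finset.prod_congr rfl fun i _ => ?_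
    push_cast [Nat.succPNat_coe]
    rw [mul_inv, inv_pow, div_eq_mul_inv]
  rw [h4, ← h2]
  push_cast
  rw [mul_assoc, mul_inv_cancel₀, mul_one]
  refine Finset.prod_ne_zero_iff.2 fun i _ => ?_
  positivity

theorem sum_spechtCharacter_mul_zinv (lam mu : n.Partition) :
    ∑ ρ : n.Partition, spechtCharacter lam (classRep ρ) * spechtCharacter mu (classRep ρ) *
      zinv (fun j => ((j : ℕ) : ℚ)⁻¹) ρ = if lam = mu then 1 else 0 := by
  have hn : (n.factorial : ℚ) ≠ 0 := by positivity
  have h := sum_spechtCharacter_mul lam mu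
  rw [← Finset.sum_fiberwise _ (fun σ => cyclePartition σ)] at h
  have h2 : ∀ ρ : n.Partition, ∑ σ with cyclePartition σ = ρ,
      spechtCharacter lam σ * spechtCharacter mu σ = n.factorial *
        (spechtCharacter lam (classRep ρ) * spechtCharacter mu (classRep ρ) *
          zinv (fun j => ((j : ℕ) : ℚ)⁻¹) ρ) := by
    intro ρ
    rw [Finset.sum_congr rfl (g := fun _ =>
      spechtCharacter lam (classRep ρ) * spechtCharacter mu (classRep ρ))]
    · rw [Finset.sum_const, nsmul_eq_mul, card_cyclePartition_eq]
      ring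
    · intro σ hσ
      have hc : IsConj σ (classRep ρ) := by
        rw [isConj_iff_cyclePartition_eq, cyclePartition_classRep]
        exact (Finset.mem_filter.1 hσ).2
      rw [spechtCharacter_eq_of_isConj lam hc, spechtCharacter_eq_of_isConj mu hc]
  rw [Finset.sum_congr rfl fun ρ _ => h2 ρ, ← Finset.mul_sum] at h
  rw [← mul_right_inj' hn, h]
  split_ifs <;> simp

end Orthonormal

/-! ## Contractions of functions of lists and Pfaffians -/

section Contraction

variable {R : Type*} [CommRing R]

/-- The contraction `∑_j (-1)^j g(l_j) φ(l ∖ l_j)`. -/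
def contr (g : ℕ → R) : (List ℕ → R) → List ℕ → R
  | _, [] => 0
  | φ, m :: l => g m * φ l - contr g (fun l' => φ (m :: l')) l

@[simp] theorem contr_nil (g : ℕ → R) (φ : List ℕ → R) : contr g φ [] = 0 := rfl

theorem contr_cons (g : ℕ → R) (φ : List ℕ → R) (m : ℕ) (l : List ℕ) :
    contr g φ (m :: l) = g m * φ l - contr g (fun l' => φ (m :: l')) l := rfl

theorem contr_eq_sum (g : ℕ → R) (φ : List ℕ → R) (l : List ℕ) :
    contr g φ l = ∑ i : Fin l.length, (-1) ^ (i : ℕ) * g (l.get i) * φ (l.eraseIdx i) := by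
  induction l generalizing φ with
  | nil => simp
  | cons m l ih =>
    rw [contr_cons, ih]
    simp only [List.length_cons]
    rw [Fin.sum_univ_succ, sub_eq_add_neg, ← Finset.sum_neg_distrib]
    congr 1
    · simp
    · refine Finset.sum_congr rfl fun i _ => ?_
      simp [pow_succ]

theorem contr_congr {g g' : ℕ → R} {φ ψ : List ℕ → R} {l : List ℕ} (hg : ∀ a ∈ l, g a = g' a)
    (h : ∀ l', l'.length + 1 = l.length → φ l' = ψ l') : contr g φ l = contr g' ψ l := by
  induction l generalizing φ ψ with
  | nil => rfl
  | cons m l ih =>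
    rw [contr_cons, contr_cons, hg m (by simp), h l (by simp),
      ih (fun a ha => hg a (by simp [ha])) fun l' hl' => h _ (by simpa using hl')]

theorem contr_zero_right (g : ℕ → R) (l : List ℕ) : contr g (fun _ => 0) l = 0 := by
  induction l with
  | nil => rfl
  | cons m l ih => rw [contr_cons, ih]; ring

theorem contr_add_right (g : ℕ → R) (φ ψ : List ℕ → R) (l : List ℕ) :
    contr g (fun x => φ x + ψ x) l = contr g φ l + contr g ψ l := by
  induction l generalizing φ ψ with
  | nil => simp
  | cons m l ih => rw [contr_cons, contr_cons, contr_cons, ih]; ring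

theorem contr_mul_right (c : R) (g : ℕ → R) (φ : List ℕ → R) (l : List ℕ) :
    contr g (fun x => c * φ x) l = c * contr g φ l := by
  induction l generalizing φ with
  | nil => simp
  | cons m l ih => rw [contr_cons, contr_cons, ih]; ring

theorem contr_sub_right (g : ℕ → R) (φ ψ : List ℕ → R) (l : List ℕ) :
    contr g (fun x => φ x - ψ x) l = contr g φ l - contr g ψ l := by
  induction l generalizing φ ψ with
  | nil => simp
  | cons m l ih => rw [contr_cons, contr_cons, contr_cons, ih]; ring

theorem contr_add_left (g h : ℕ → R) (φ : List ℕ → R) (l : List ℕ) :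
    contr (fun a => g a + h a) φ l = contr g φ l + contr h φ l := by
  induction l generalizing φ with
  | nil => simp
  | cons m l ih => rw [contr_cons, contr_cons, contr_cons, ih]; ring

theorem contr_mul_left (c : R) (g : ℕ → R) (φ : List ℕ → R) (l : List ℕ) :
    contr (fun a => c * g a) φ l = c * contr g φ l := by
  induction l generalizing φ with
  | nil => simp
  | cons m l ih => rw [contr_cons, contr_cons, ih]; ring

theorem map_contr {S : Type*} [CommRing S] (F : R →+* S) (g : ℕ → R) (φ : List ℕ → R)
    (l : List ℕ) : F (contr g φ l) = contr (fun a => F (g a)) (fun x => F (φ x)) l := by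
  induction l generalizing φ with
  | nil => simp
  | cons m l ih => rw [contr_cons, contr_cons, map_sub, map_mul, ih]

theorem contr_contr_cons (g h : ℕ → R) (φ : List ℕ → R) (m : ℕ) (l : List ℕ) :
    contr g (contr h φ) (m :: l) = g m * contr h φ l - h m * contr g φ l +
      contr g (contr h fun l' => φ (m :: l')) l := by
  rw [contr_cons]
  simp only [contr_cons]
  rw [contr_sub_right, contr_mul_right]
  ring

/-- The operators `contr g` behave like interior products with covectors: they anticommute and
square to zero. The Pfaffian identities below rest on this. -/
theorem contr_anticomm (g h : ℕ → R) (φ : List ℕ → R) (l : List ℕ) :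
    contr g (contr h φ) l = - contr h (contr g φ) l := by
  induction l generalizing φ with
  | nil => simp
  | cons m l ih =>
    rw [contr_contr_cons, contr_contr_cons, ih]
    ring

theorem contr_self (g : ℕ → R) (φ : List ℕ → R) (l : List ℕ) : contr g (contr g φ) l = 0 := by
  induction l generalizing φ with
  | nil => simp
  | cons m l ih =>
    rw [contr_contr_cons, ih]
    ring

theorem contr_left_anticomm (k g h : ℕ → R) (φ : List ℕ → R) (l : List ℕ) :
    contr k (contr g (contr h φ)) l = - contr k (contr h (contr g φ)) l := by
  rw [← neg_one_mul (contr k _ l), ← contr_mul_right]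
  exact contr_congr (fun _ _ => rfl) fun l' _ => by rw [contr_anticomm, neg_one_mul]

theorem contr_append_singleton (g : ℕ → R) (φ : List ℕ → R) (l : List ℕ) (a : ℕ) :
    contr g φ (l ++ [a]) =
      contr g (fun l' => φ (l' ++ [a])) l + (-1) ^ l.length * g a * φ l := by
  induction l generalizing φ with
  | nil => simp [contr_cons]
  | cons m l ih =>
    rw [List.cons_append, contr_cons, contr_cons, ih]
    simp only [List.length_cons, List.cons_append]
    ring

/-- A contraction of `f_i` against an alternating perturbation of rank two. -/
theorem contr_rank_two (b q h : ℕ → R) (φ : List ℕ → R) (x y : R) (l : List ℕ) :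
    contr (fun a => b a + 2 * x * q a - 2 * y * h a)
        (fun l' => φ l' + 2 * contr h (contr q φ) l') l =
      contr b φ l + 2 * (x * contr q φ l - y * contr h φ l + contr h (contr q (contr b φ)) l) := by
  have e : (fun a => b a + 2 * x * q a - 2 * y * h a) =
      fun a => (b a + 2 * x * q a) + (-(2 * y)) * h a := by funext a; ring
  -- Triple contractions in which `q` or `h` is repeated vanish; the survivor contains `b`, `q`, `h`
  -- once each.
  have h1 : contr q (contr h (contr q φ)) l = 0 := by
    rw [contr_left_anticomm, contr_self, neg_zero]
  have h2 : contr b (contr h (contr q φ)) l = contr h (contr q (contr b φ)) l := by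
    rw [contr_anticomm, contr_left_anticomm, neg_neg]
  rw [e, contr_add_left, contr_add_left, contr_mul_left, contr_mul_left]
  simp only [contr_add_right, contr_mul_right]
  rw [h1, h2, contr_self]
  ring

/-- The Pfaffian, by expansion along the first row. -/
def pf (f : ℕ → ℕ → R) : List ℕ → R
  | [] => 1
  | x :: l => ∑ i : Fin l.length, (-1) ^ (i : ℕ) * f x (l.get i) * pf f (l.eraseIdx i)
termination_by l => l.length
decreasing_by
  have := i.isLt
  simp only [List.length_eraseIdx, List.length_cons]
  split <;> omega

theorem pf_nil (f : ℕ → ℕ → R) : pf f [] = 1 := by rw [pf]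

theorem pf_cons (f : ℕ → ℕ → R) (m : ℕ) (l : List ℕ) : pf f (m :: l) = contr (f m) (pf f) l := by
  rw [contr_eq_sum, pf]

theorem map_pf {S : Type*} [CommRing S] (F : R →+* S) (f : ℕ → ℕ → R) (l : List ℕ) :
    F (pf f l) = pf (fun a b => F (f a b)) l := by
  match l with
  | [] => simp [pf_nil]
  | m :: l =>
    rw [pf_cons, pf_cons, map_contr]
    exact contr_congr (fun _ _ => rfl) fun l' hl' => by
      have : l'.length < l.length + 1 := by omega
      exact map_pf F f l'
termination_by l.length

theorem pf_eq_zero_of_odd (f : ℕ → ℕ → R) (l : List ℕ) (hl : Odd l.length) : pf f l = 0 := by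
  match l with
  | [] => simp at hl
  | m :: l =>
    rw [pf_cons, ← contr_zero_right (f m) l]
    refine contr_congr (fun _ _ => rfl) fun l' hl' => ?_
    have : l'.length < l.length + 1 := by omega
    refine pf_eq_zero_of_odd f l' ?_
    rw [List.length_cons] at hl
    rw [← hl', Nat.odd_add_one, Nat.not_odd_iff_even, Nat.even_add_one, Nat.not_even_iff_odd] at hl
    exact hl
termination_by l.length

/-- The Pfaffian of a perturbation of rank two. -/
theorem pf_rank_two (b : ℕ → ℕ → R) (q h : ℕ → R) (l : List ℕ) :
    pf (fun m a => b m a + 2 * h m * q a - 2 * q m * h a) l =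
      pf b l + 2 * contr h (contr q (pf b)) l := by
  match l with
  | [] => simp [pf_nil]
  | m :: l =>
    rw [pf_cons, contr_congr (ψ := fun l' => pf b l' + 2 * contr h (contr q (pf b)) l')
      (fun _ _ => rfl) fun l' hl' => by
        have : l'.length < l.length + 1 := by omega
        exact pf_rank_two b q h l',
      contr_rank_two, contr_contr_cons, pf_cons]
    simp only [pf_cons]
termination_by l.length

/-- Appending a last index for which the matrix entries are `q`. -/
theorem pf_append_singleton (b : ℕ → ℕ → R) (q : ℕ → R) (c : ℕ) (hc : ∀ m, b m c = q m)
    (l : List ℕ) (hl : Odd l.length) : pf b (l ++ [c]) = contr q (pf b) l := by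
  match l with
  | [] => simp at hl
  | m :: l =>
    have hl' : Even l.length := by
      rw [List.length_cons, Nat.odd_add_one, Nat.not_odd_iff_even] at hl
      exact hl
    rw [List.cons_append, pf_cons, contr_append_singleton, hc, hl'.neg_one_pow, one_mul,
      contr_congr (ψ := contr q (pf b)) (fun _ _ => rfl) fun l' hl'' => by
        have : l'.length < l.length + 1 := by omega
        refine pf_append_singleton b q c hc l' ?_
        rw [← hl'', Nat.even_add_one, Nat.not_even_iff_odd] at hl'
        exact hl',
      contr_cons, contr_anticomm]
    simp only [pf_cons]
    ring
termination_by l.length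

/-- The Pfaffian extended to lists of odd length by a bordering vector. -/
def pfBorder (b : ℕ → ℕ → R) (q : ℕ → R) (l : List ℕ) : R := pf b l + contr q (pf b) l

theorem pfBorder_nil (b : ℕ → ℕ → R) (q : ℕ → R) : pfBorder b q [] = 1 := by
  simp [pfBorder, pf_nil]

/-- The leading term `q m` is split off from the first row. For `b = qTwo`, `q = qOne` the remainder
`b m a - q m * q a` is a combination of products containing some `q_{m+i}` with `i ≥ 1`, as
`pair_listQ_cons` requires. -/
theorem pfBorder_cons (b : ℕ → ℕ → R) (q : ℕ → R) (m : ℕ) (l : List ℕ) :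
    pfBorder b q (m :: l) =
      q m * pfBorder b q l + contr (fun a => b m a - q m * q a) (pfBorder b q) l := by
  have e : (fun a => b m a - q m * q a) = fun a => b m a + (- q m) * q a := by funext a; ring
  have e2 : ∀ g : ℕ → R, contr g (pfBorder b q) l =
      contr g (pf b) l + contr g (contr q (pf b)) l := fun g => contr_add_right _ _ _ _
  rw [e, contr_add_left, contr_mul_left, e2, e2, contr_self, pfBorder, pf_cons, contr_cons,
    pfBorder, contr_anticomm (b m)]
  simp only [pf_cons]
  ring

/-- These are the changes that `shift` makes to `qTwo` and to the border `qOne`; their joint effect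
is a single contraction with `h`, which removes one part. -/
theorem pfBorder_rank_two (b : ℕ → ℕ → R) (q h : ℕ → R) (l : List ℕ) :
    pfBorder (fun m a => b m a + 2 * h m * q a - 2 * q m * h a) (fun a => q a + 2 * h a) l =
      pfBorder b q l + 2 * contr h (pfBorder b q) l := by
  have e : contr h (pfBorder b q) l = contr h (pf b) l + contr h (contr q (pf b)) l :=
    contr_add_right _ _ _ _
  have h1 : contr q (contr h (contr q (pf b))) l = 0 := by
    rw [contr_left_anticomm, contr_self, neg_zero]
  rw [pfBorder, pf_rank_two, contr_congr (fun _ _ => rfl) fun l' _ => pf_rank_two b q h l',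
    contr_add_left, contr_mul_left, e, pfBorder]
  simp only [contr_add_right, contr_mul_right]
  rw [h1, contr_self]
  ring

theorem map_pfBorder {S : Type*} [CommRing S] (F : R →+* S) (b : ℕ → ℕ → R) (q : ℕ → R)
    (l : List ℕ) : F (pfBorder b q l) = pfBorder (fun m a => F (b m a)) (fun a => F (q a)) l := by
  rw [pfBorder, pfBorder, map_add, map_contr, map_pf]
  simp only [map_pf]

end Contraction

theorem pfaffian_eq_pf (f : ℕ → ℕ → V) (l : List ℕ) : pfaffian f l = pf f l := by
  match l with
  | [] => rw [pfaffian, pf]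
  | m :: l =>
    rw [pfaffian, pf]
    refine Finset.sum_congr rfl fun i _ => ?_
    have : (l.eraseIdx i).length < l.length + 1 := by
      have := List.length_eraseIdx_le l i
      omega
    rw [pfaffian_eq_pf f (l.eraseIdx i)]
termination_by l.length

/-! ## The functions `q_n` -/

section QOne

/-- All variables of the exponent have odd index. -/
def IsOddExp (d : ℕ+ →₀ ℕ) : Prop := ∀ j ∈ d.support, Odd (j : ℕ)

theorem isOddExp_pexp {n : ℕ} (ρ : n.Partition) :
    IsOddExp (pexp ρ) ↔ ρ ∈ Nat.Partition.odds n := by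
  simp only [IsOddExp, Nat.Partition.odds, Nat.Partition.restricted, Finset.mem_filter,
    Finset.mem_univ, true_and, Finsupp.mem_support_iff, pexp_apply, ne_eq, Multiset.count_eq_zero,
    not_not, Nat.not_even_iff_odd]
  exact ⟨fun h i hi => h ⟨i, ρ.parts_pos hi⟩ hi, fun h j hj => h _ hj⟩

open Classical in
theorem coeff_qOne (n : ℕ) (d : ℕ+ →₀ ℕ) :
    (qOne n).coeff d =
      if wdeg d = n ∧ IsOddExp d then d.prod fun _ m => ((m.factorial : ℚ))⁻¹ else 0 := by
  rw [qOne, MvPolynomial.coeff_sum]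
  split_ifs with h
  · obtain ⟨h1, h2⟩ := h
    obtain ⟨ρ, rfl⟩ := exists_pexp_eq_of_wdeg h1
    rw [Finset.sum_eq_single ρ]
    · rw [tMonomial_eq, MvPolynomial.coeff_monomial, if_pos rfl]
    · intro σ _ hσ
      rw [tMonomial_eq, MvPolynomial.coeff_monomial, if_neg fun h => hσ (pexp_injective h)]
    · exact fun h => absurd ((isOddExp_pexp ρ).1 h2) h
  · refine Finset.sum_eq_zero fun ρ hρ => ?_
    rw [tMonomial_eq, MvPolynomial.coeff_monomial, if_neg]
    rintro rfl
    exact h ⟨wdeg_pexp ρ, (isOddExp_pexp ρ).2 hρ⟩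

theorem of_coeff_qOne_ne_zero {n : ℕ} {d : ℕ+ →₀ ℕ} (h : (qOne n).coeff d ≠ 0) :
    wdeg d = n ∧ IsOddExp d := by
  rw [coeff_qOne] at h
  by_contra h'
  exact h (if_neg h')

theorem wdeg_single (j : ℕ+) (m : ℕ) : wdeg (Finsupp.single j m) = m * j :=
  Finsupp.sum_single_index (by simp)

theorem eq_zero_of_wdeg_eq_zero {d : ℕ+ →₀ ℕ} (h : wdeg d = 0) : d = 0 := by
  ext j
  by_contra hj
  have h1 : d j * (j : ℕ) ≤ wdeg d :=
    Finset.single_le_sum (f := fun j : ℕ+ => d j * (j : ℕ)) (fun _ _ => Nat.zero_le _)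
      (Finsupp.mem_support_iff.2 hj)
  have h2 : 0 < d j * (j : ℕ) := Nat.mul_pos (Nat.pos_of_ne_zero hj) j.2
  omega

theorem qOne_zero : qOne 0 = 1 := by
  ext d
  rw [coeff_qOne, MvPolynomial.coeff_one]
  by_cases h : d = 0
  · subst h
    rw [if_pos ⟨rfl, by simp [IsOddExp]⟩, if_pos rfl]
    simp
  · rw [if_neg fun h' => h (eq_zero_of_wdeg_eq_zero h'.1), if_neg fun h' => h h'.symm]

theorem prod_inv_factorial_add_single (d : ℕ+ →₀ ℕ) (j : ℕ+) :
    ((d + Finsupp.single j 1).prod fun _ m => ((m.factorial : ℚ))⁻¹) * (d j + 1) =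
      d.prod fun _ m => ((m.factorial : ℚ))⁻¹ := by
  have h : ∀ e : ℕ+ →₀ ℕ, e.prod (fun _ m => ((m.factorial : ℚ))⁻¹) =
      (e.erase j).prod (fun _ m => ((m.factorial : ℚ))⁻¹) * ((e j).factorial : ℚ)⁻¹ := fun e => by
    rw [mul_comm]
    exact (Finsupp.mul_prod_erase' e j (fun _ m => ((m.factorial : ℚ))⁻¹) (by simp)).symm
  rw [h d, h (d + Finsupp.single j 1), Finsupp.erase_add, Finsupp.erase_single, add_zero,
    Finsupp.add_apply, Finsupp.single_eq_same, Nat.factorial_succ, mul_assoc]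
  congr 1
  have : ((d j).factorial : ℚ) ≠ 0 := by positivity
  have h2 : (d j + 1 : ℚ) ≠ 0 := by positivity
  push_cast
  field_simp

theorem isOddExp_add_single (d : ℕ+ →₀ ℕ) (j : ℕ+) :
    IsOddExp (d + Finsupp.single j 1) ↔ IsOddExp d ∧ Odd (j : ℕ) := by
  simp only [IsOddExp, Finsupp.mem_support_iff, Finsupp.add_apply]
  constructor
  · intro h
    exact ⟨fun i hi => h i (by omega), h j (by simp)⟩
  · rintro ⟨h1, h2⟩ i hi
    by_cases hij : i = j
    · rwa [hij]
    · rw [Finsupp.single_eq_of_ne hij, add_zero] at hi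
      exact h1 i hi

/-- For odd `j`, differentiating the generating function `exp (∑ t_j z^j)` by `t_j` multiplies it by
`z^j`. -/
theorem pderiv_qOne (n : ℕ) (j : ℕ+) :
    MvPolynomial.pderiv j (qOne n) =
      if Odd (j : ℕ) ∧ (j : ℕ) ≤ n then qOne (n - j) else 0 := by
  ext d
  rw [MvPolynomial.coeff_pderiv, coeff_qOne, wdeg_add, wdeg_single, one_mul, isOddExp_add_single]
  split_ifs with h1 h2 h2
  · rw [coeff_qOne, if_pos ⟨by omega, h1.2.1⟩, prod_inv_factorial_add_single]
  · exact absurd ⟨h1.2.2, by omega⟩ h2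
  · rw [coeff_qOne, if_neg, zero_mul]
    rintro ⟨h3, h4⟩
    exact h1 ⟨by omega, h4, h2.1⟩
  · simp

/-- Euler's identity for the weighted degree. It serves as a recursion for `q_n`. -/
theorem euler_qOne (n : ℕ) :
    (n : ℚ) • qOne n = ∑ i ∈ Finset.range n,
      if Odd (i + 1) then ((i + 1 : ℕ) : ℚ) • (MvPolynomial.X i.succPNat * qOne (n - (i + 1)))
      else 0 := by
  have h1 : ∀ i ∈ Finset.range n, (if Odd (i + 1) then
      ((i + 1 : ℕ) : ℚ) • (MvPolynomial.X i.succPNat * qOne (n - (i + 1))) else 0) =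
      ((i + 1 : ℕ) : ℚ) •
        (MvPolynomial.X i.succPNat * MvPolynomial.pderiv i.succPNat (qOne n)) := by
    intro i hi
    have hi' : i + 1 ≤ n := Finset.mem_range.1 hi
    rw [pderiv_qOne, Nat.succPNat_coe, Nat.succ_eq_add_one]
    by_cases h : Odd (i + 1) <;> simp [h, hi']
  rw [Finset.sum_congr rfl h1]
  ext d
  rw [MvPolynomial.coeff_smul, MvPolynomial.coeff_sum]
  have h2 : ∀ i ∈ Finset.range n, MvPolynomial.coeff d (((i + 1 : ℕ) : ℚ) •
        (MvPolynomial.X i.succPNat * MvPolynomial.pderiv i.succPNat (qOne n))) =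
      ((d i.succPNat * (i + 1) : ℕ) : ℚ) * (qOne n).coeff d := by
    intro i _
    rw [MvPolynomial.coeff_smul, MvPolynomial.coeff_X_mul']
    split_ifs with h
    · have hd : d - Finsupp.single i.succPNat 1 + Finsupp.single i.succPNat 1 = d :=
        tsub_add_cancel_of_le (Finsupp.single_le_iff.2
          (Nat.one_le_iff_ne_zero.2 (Finsupp.mem_support_iff.1 h)))
      have hd2 : ((d - Finsupp.single i.succPNat 1 : ℕ+ →₀ ℕ) i.succPNat : ℚ) + 1 = d i.succPNat := by
        have := DFunLike.congr_fun hd i.succPNat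
        rw [Finsupp.add_apply, Finsupp.single_eq_same] at this
        exact_mod_cast this
      rw [MvPolynomial.coeff_pderiv, hd, hd2, smul_eq_mul]
      push_cast
      ring
    · rw [Finsupp.notMem_support_iff.1 h]
      simp
  rw [Finset.sum_congr rfl h2, ← Finset.sum_mul, ← Nat.cast_sum, smul_eq_mul]
  by_cases h : (qOne n).coeff d = 0
  · rw [h, mul_zero, mul_zero]
  · have h3 := (of_coeff_qOne_ne_zero h).1
    obtain ⟨ρ, rfl⟩ := exists_pexp_eq_of_wdeg h3
    have h4 := wdeg_pexp ρ
    rw [wdeg, pexp_sum _ _ (by simp)] at h4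
    congr 2
    refine h4.symm.trans (Finset.sum_congr rfl fun i _ => ?_)
    rw [pexp_apply]
    rfl

end QOne

/-! ## The shift `t_j ↦ t_j + (2/j) z^j`, adjoint to the multiplication by `q_n` -/

section Shift

open Polynomial in
/-- The substitution `t_j ↦ t_j + (2/j) z^j` for odd `j`. -/
def shift : V →ₐ[ℚ] V[X] :=
  MvPolynomial.aeval fun j : ℕ+ => Polynomial.C (MvPolynomial.X j) +
    if Odd (j : ℕ) then Polynomial.C (MvPolynomial.C (2 / (j : ℕ) : ℚ)) * Polynomial.X ^ (j : ℕ)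
    else 0

open Polynomial in
-- Both sides are derivations along `shift`, so it suffices to check the variables, where `z d/dz`
-- of `(2/j) z^j` is `2 z^j`.
theorem derivative_shift (J : Finset ℕ+) {f : V} (hf : f ∈ MvPolynomial.supported ℚ (J : Set ℕ+)) :
    Polynomial.X * Polynomial.derivative (shift f) =
      ∑ j ∈ J, if Odd (j : ℕ) then
        2 * (Polynomial.X ^ (j : ℕ) * shift (MvPolynomial.pderiv j f)) else 0 := by
  induction hf using Algebra.adjoin_induction with
  | mem x hx =>
    obtain ⟨j, hj, rfl⟩ := hx
    rw [Finset.sum_eq_single j]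
    · rw [MvPolynomial.pderiv_X_self, map_one, shift, MvPolynomial.aeval_X]
      split_ifs with h
      · have hj0 : ((j : ℕ) : ℚ) ≠ 0 := by positivity
        have hc : (Polynomial.C (MvPolynomial.C (2 / (j : ℕ) : ℚ)) : V[X]) * ((j : ℕ) : V[X]) =
            2 := by
          rw [← map_natCast (Polynomial.C : V →+* V[X]), ← map_natCast (MvPolynomial.C : ℚ →+* V),
            ← map_mul, ← map_mul, div_mul_cancel₀ _ hj0, map_ofNat, map_ofNat]
        have hp : (Polynomial.X : V[X]) * Polynomial.X ^ ((j : ℕ) - 1) =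
            Polynomial.X ^ (j : ℕ) := by
          rw [← pow_succ', Nat.sub_add_cancel (show 1 ≤ (j : ℕ) from j.2)]
        rw [Polynomial.derivative_add, Polynomial.derivative_C, Polynomial.derivative_C_mul,
          Polynomial.derivative_X_pow, zero_add, ← hp, ← hc]
        simp only [map_natCast]
        ring
      · simp
    · intro i _ hi
      rw [MvPolynomial.pderiv_X_of_ne hi.symm]
      simp
    · exact fun h => absurd hj h
  | algebraMap r => simp
  | add x y _ _ hx hy =>
    rw [map_add, Polynomial.derivative_add, mul_add, hx, hy, ← Finset.sum_add_distrib]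
    refine Finset.sum_congr rfl fun j _ => ?_
    split_ifs
    · rw [map_add, map_add]; ring
    · rw [add_zero]
  | mul x y _ _ hx hy =>
    have : Polynomial.X * Polynomial.derivative (shift (x * y)) =
        (Polynomial.X * Polynomial.derivative (shift x)) * shift y +
          shift x * (Polynomial.X * Polynomial.derivative (shift y)) := by
      rw [map_mul, Polynomial.derivative_mul]
      ring
    rw [this, hx, hy, Finset.sum_mul, Finset.mul_sum, ← Finset.sum_add_distrib]
    refine Finset.sum_congr rfl fun j _ => ?_
    split_ifs
    · rw [MvPolynomial.pderiv_mul, map_add, map_mul, map_mul]; ring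
    · ring

theorem coeff_shift (f : V) (k : ℕ) :
    (k : ℚ) • (shift f).coeff k = ∑ i ∈ Finset.range k, if Odd (i + 1) then
      (2 : ℚ) • (shift (MvPolynomial.pderiv i.succPNat f)).coeff (k - (i + 1)) else 0 := by
  -- The indices up to `k` are adjoined so that the sum can be taken over all of them; larger
  -- indices do not reach `z^k`.
  have hf : f ∈ MvPolynomial.supported ℚ
      ((f.vars ∪ (Finset.range k).image Nat.succPNat : Finset ℕ+) : Set ℕ+) := by
    rw [MvPolynomial.mem_supported]
    simp
  have h := congrArg (fun p => Polynomial.coeff p k) (derivative_shift _ hf)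
  have h0 : (Polynomial.X * Polynomial.derivative (shift f)).coeff k =
      (k : ℚ) • (shift f).coeff k := by
    cases k with
    | zero => simp
    | succ k =>
      rw [Polynomial.coeff_X_mul, Polynomial.coeff_derivative, Algebra.smul_def, mul_comm]
      simp
  rw [h0] at h
  rw [h, Polynomial.finsetSum_coeff,
    ← Finset.sum_subset (s₁ := (Finset.range k).image Nat.succPNat) Finset.subset_union_right]
  · rw [Finset.sum_image fun a _ b _ h => Nat.succPNat_injective h]
    refine Finset.sum_congr rfl fun i hi => ?_
    have hi' : i + 1 ≤ k := Finset.mem_range.1 hi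
    rw [Nat.succPNat_coe, Nat.succ_eq_add_one]
    split_ifs
    · rw [two_mul, Polynomial.coeff_add, Polynomial.coeff_X_pow_mul', if_pos hi', two_smul]
    · simp
  · intro j _ hj
    have hjk : ¬ (j : ℕ) ≤ k := fun h' => hj (Finset.mem_image.2 ⟨j.natPred, by
      have := j.natPred_add_one
      exact Finset.mem_range.2 (by omega), by simp⟩)
    split_ifs
    · rw [two_mul, Polynomial.coeff_add, Polynomial.coeff_X_pow_mul', if_neg hjk, add_zero]
    · simp

theorem coeff_zero_shift (f : V) : (shift f).coeff 0 = f := by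
  have : (Polynomial.constantCoeff : Polynomial V →+* V).comp (shift : V →+* Polynomial V) =
      RingHom.id V := by
    refine MvPolynomial.ringHom_ext (fun r => ?_) fun j => ?_
    · simp [← MvPolynomial.algebraMap_eq, Polynomial.algebraMap_apply]
    · simp only [RingHom.comp_apply, RingHom.coe_coe, shift, MvPolynomial.aeval_X]
      split_ifs <;> simp [j.ne_zero.symm]
  simpa using RingHom.congr_fun this f

/-- The weights of the form for which Schur's `Q`-functions are orthogonal. -/
def qWeight (j : ℕ+) : ℚ := 2 / (j : ℕ)

theorem pair_X_mul (w : ℕ+ → ℚ) (j : ℕ+) (f g : V) :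
    pair w (MvPolynomial.X j * f) g = w j * pair w f (MvPolynomial.pderiv j g) := by
  induction f using MvPolynomial.induction_on' with
  | monomial d a =>
    rw [MvPolynomial.X, MvPolynomial.monomial_mul, one_mul, add_comm, pair_monomial, pair_monomial,
      MvPolynomial.coeff_pderiv]
    have h : ∀ e : ℕ+ →₀ ℕ, wnorm w e =
        wnorm w (e.erase j) * ((e j).factorial * w j ^ (e j)) := fun e => by
      rw [mul_comm]
      exact (Finsupp.mul_prod_erase' e j (fun j m => (m.factorial : ℚ) * w j ^ m) (by simp)).symm
    rw [h d, h (d + Finsupp.single j 1), Finsupp.erase_add, Finsupp.erase_single, add_zero,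
      Finsupp.add_apply, Finsupp.single_eq_same, Nat.factorial_succ, pow_succ]
    push_cast
    ring
  | add p q hp hq =>
    rw [mul_add, map_add, LinearMap.add_apply, hp, hq, map_add, LinearMap.add_apply]
    ring

/-- Both sides obey the same recursion in `k`, from `euler_qOne` on the left and `coeff_shift` on
the right. The factors agree because `j · (2/j) = 2`. -/
theorem pair_qOne_mul (k : ℕ) (f g : V) :
    pair qWeight (qOne k * f) g = pair qWeight f ((shift g).coeff k) := by
  induction k using Nat.strong_induction_on generalizing g with
  | _ k ih =>
    rcases Nat.eq_zero_or_pos k with rfl | hk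
    · rw [qOne_zero, one_mul, coeff_zero_shift]
    · have hk' : (k : ℚ) ≠ 0 := by positivity
      have h1 : (k : ℚ) * pair qWeight (qOne k * f) g =
          pair qWeight (((k : ℚ) • qOne k) * f) g := by
        rw [smul_mul_assoc, map_smul, LinearMap.smul_apply, smul_eq_mul]
      have h2 : (k : ℚ) * pair qWeight f ((shift g).coeff k) =
          pair qWeight f ((k : ℚ) • (shift g).coeff k) := by
        rw [map_smul, smul_eq_mul]
      rw [← mul_right_inj' hk', h1, h2, euler_qOne, coeff_shift, Finset.sum_mul, map_sum, map_sum,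
        LinearMap.sum_apply]
      refine Finset.sum_congr rfl fun i hi => ?_
      have hi' : i + 1 ≤ k := Finset.mem_range.1 hi
      split_ifs
      · have hj : ((i + 1 : ℕ) : ℚ) ≠ 0 := by positivity
        rw [smul_mul_assoc, map_smul, LinearMap.smul_apply, mul_assoc, pair_X_mul,
          ih _ (by omega), map_smul, smul_eq_mul, smul_eq_mul, ← mul_assoc, qWeight,
          Nat.succPNat_coe, Nat.succ_eq_add_one, mul_div_cancel₀ _ hj]
      · simp

/-- The non-constant half of the shift of `q_n`. -/
def qShift (n : ℕ) : Polynomial V :=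
  ∑ i ∈ Finset.range n, Polynomial.C (qOne (n - (i + 1))) * Polynomial.X ^ (i + 1)

theorem qShift_zero : qShift 0 = 0 := rfl

theorem qShift_succ (n : ℕ) :
    qShift (n + 1) = Polynomial.X * (Polynomial.C (qOne n) + qShift n) := by
  have h : ∀ i ∈ Finset.range n,
      Polynomial.C (qOne (n + 1 - (i + 1 + 1))) * Polynomial.X ^ (i + 1 + 1) =
        Polynomial.X * (Polynomial.C (qOne (n - (i + 1))) * Polynomial.X ^ (i + 1)) := by
    intro i _
    rw [Nat.add_sub_add_right, pow_succ']
    ring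
  rw [qShift, Finset.sum_range_succ', Finset.sum_congr rfl h, ← Finset.mul_sum, ← qShift,
    zero_add, pow_one, Nat.add_sub_cancel]
  ring

theorem coeff_qShift (n k : ℕ) :
    (qShift n).coeff k = if 0 < k ∧ k ≤ n then qOne (n - k) else 0 := by
  rw [qShift, Polynomial.finsetSum_coeff]
  simp only [Polynomial.coeff_C_mul_X_pow]
  split_ifs with h
  · rw [Finset.sum_eq_single (k - 1)]
    · rw [Nat.sub_add_cancel h.1, if_pos rfl]
    · intro i _ hi
      rw [if_neg (by omega)]
    · intro h'
      exact absurd (Finset.mem_range.2 (by omega)) h'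
  · refine Finset.sum_eq_zero fun i hi => ?_
    rw [if_neg]
    rintro rfl
    exact h ⟨by omega, Finset.mem_range.1 hi⟩

theorem sum_odd_two (k : ℕ) :
    ∑ i ∈ Finset.range k, (if Odd (i + 1) then (2 : ℚ) else 0) = k + if Odd k then 1 else 0 := by
  induction k with
  | zero => simp
  | succ k ih =>
    rw [Finset.sum_range_succ, ih]
    rcases Nat.even_or_odd k with h | h
    · have h2 : ¬ Odd k := Nat.not_odd_iff_even.2 h
      simp [h2, h.add_one]
      ring
    · have h2 : ¬ Odd (k + 1) := Nat.not_odd_iff_even.2 h.add_one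
      simp [h2, h]

/-- The shift multiplies the generating function `∑ q_n u^n` by `exp (∑_{j odd} (2/j)(zu)^j) = (1 +
zu)/(1 - zu) = 1 + 2 ∑_{k ≥ 1} (zu)^k`. -/
theorem coeff_shift_qOne (n k : ℕ) :
    (shift (qOne n)).coeff k =
      if k = 0 then qOne n else if k ≤ n then (2 : ℚ) • qOne (n - k) else 0 := by
  induction k using Nat.strong_induction_on generalizing n with
  | _ k ih =>
    cases k with
    | zero => rw [if_pos rfl, coeff_zero_shift]
    | succ k =>
      rw [if_neg (by omega)]
      have hk' : ((k + 1 : ℕ) : ℚ) ≠ 0 := by positivity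
      refine (smul_right_injective V hk') ?_
      dsimp only
      rw [coeff_shift]
      by_cases hkn : k + 1 ≤ n
      · rw [if_pos hkn]
        -- The summand `i = k` meets a constant coefficient, hence the factor `1` there and `2`
        -- elsewhere.
        have h : ∀ i ∈ Finset.range (k + 1), (if Odd (i + 1) then (2 : ℚ) •
            (shift (MvPolynomial.pderiv i.succPNat (qOne n))).coeff (k + 1 - (i + 1)) else 0) =
            ((if Odd (i + 1) then (2 : ℚ) else 0) *
              (if i = k then 1 else 2)) • qOne (n - (k + 1)) := by
          intro i hi
          have hi' := Finset.mem_range.1 hi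
          rw [pderiv_qOne, Nat.succPNat_coe, Nat.succ_eq_add_one]
          by_cases ho : Odd (i + 1)
          · rw [if_pos ho, if_pos ho, if_pos ⟨ho, by omega⟩, ih _ (by omega)]
            by_cases hik : i = k
            · rw [if_pos hik, if_pos (by omega), hik, mul_one]
            · rw [if_neg hik, if_neg (by omega), if_pos (by omega), smul_smul]
              congr 2
              omega
          · rw [if_neg ho, if_neg ho, zero_mul, zero_smul]
        rw [Finset.sum_congr rfl h, ← Finset.sum_smul, smul_smul]
        congr 1
        rw [Finset.sum_range_succ, if_pos rfl, mul_one]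
        have h2 : ∀ i ∈ Finset.range k, (if Odd (i + 1) then (2 : ℚ) else 0) *
            (if i = k then 1 else 2) = (if Odd (i + 1) then (2 : ℚ) else 0) * 2 := fun i hi => by
          rw [if_neg (Finset.mem_range.1 hi).ne]
        rw [Finset.sum_congr rfl h2, ← Finset.sum_mul, sum_odd_two]
        push_cast
        rcases Nat.even_or_odd k with h | h
        · have h2 : ¬ Odd k := Nat.not_odd_iff_even.2 h
          simp [h2, h.add_one]
          ring
        · have h2 : ¬ Odd (k + 1) := Nat.not_odd_iff_even.2 h.add_one
          simp [h2, h]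
      · rw [if_neg hkn, smul_zero]
        refine Finset.sum_eq_zero fun i hi => ?_
        have hi' := Finset.mem_range.1 hi
        rw [pderiv_qOne, Nat.succPNat_coe, Nat.succ_eq_add_one]
        split_ifs with h1 h2
        · rw [ih _ (by omega), if_neg (by omega), if_neg (by omega), smul_zero]
        · simp
        · rfl

theorem shift_qOne (n : ℕ) : shift (qOne n) = Polynomial.C (qOne n) + 2 * qShift n := by
  ext1 k
  rw [coeff_shift_qOne, Polynomial.coeff_add, two_mul, Polynomial.coeff_add, coeff_qShift,
    Polynomial.coeff_C]
  by_cases h : k = 0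
  · simp [h]
  · have : 0 < k := Nat.pos_of_ne_zero h
    simp only [h, this, if_false, true_and, zero_add]
    split_ifs
    · rw [two_smul]
    · rw [add_zero]

end Shift

/-! ## Orthogonality of the `Q`-functions -/

section QFunctions

theorem qTwo_zero_right (a : ℕ) : qTwo a 0 = qOne a := by
  simp [qTwo, qOne_zero]

/-- Trading `b + 1` for `a + 1` allows induction on `b` with `a` arbitrary, without the condition `a
> b`. -/
theorem qTwo_succ_right (a b : ℕ) :
    qTwo a (b + 1) = qOne a * qOne (b + 1) - qOne (a + 1) * qOne b - qTwo (a + 1) b := by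
  have h : ∀ a b, qTwo a b = qOne a * qOne b +
      2 * ∑ i ∈ Finset.range b, (-1) ^ (i + 1) * (qOne (a + (i + 1)) * qOne (b - (i + 1))) := by
    intro a b
    rw [qTwo, show Finset.Icc 1 b = Finset.Ico 1 (b + 1) by ext; simp,
      Finset.sum_Ico_eq_sum_range]
    simp only [Nat.add_sub_cancel, add_comm 1]
  rw [h, h, Finset.sum_range_succ']
  have e : ∀ i ∈ Finset.range b, (-1 : V) ^ (i + 1 + 1) *
      (qOne (a + (i + 1 + 1)) * qOne (b + 1 - (i + 1 + 1))) =
      - ((-1) ^ (i + 1) * (qOne (a + 1 + (i + 1)) * qOne (b - (i + 1)))) := by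
    intro i _
    rw [show a + (i + 1 + 1) = a + 1 + (i + 1) by ring, Nat.add_sub_add_right, pow_succ]
    ring
  rw [Finset.sum_congr rfl e, Finset.sum_neg_distrib]
  simp only [zero_add, pow_one, Nat.add_sub_cancel]
  ring

/-- The products of two `qShift`s cancel in the recursion, so the matrix is perturbed by rank two
exactly as in `pfBorder_rank_two`. -/
theorem shift_qTwo (a b : ℕ) :
    shift (qTwo a b) = Polynomial.C (qTwo a b) + 2 * qShift a * Polynomial.C (qOne b) -
      2 * Polynomial.C (qOne a) * qShift b := by
  induction b generalizing a with
  | zero => rw [qTwo_zero_right, shift_qOne, qShift_zero, qOne_zero, map_one]; ring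
  | succ b ih =>
    rw [qTwo_succ_right, map_sub, map_sub, map_mul, map_mul, ih, shift_qOne, shift_qOne,
      shift_qOne, shift_qOne, qShift_succ, qShift_succ]
    simp only [map_sub, map_mul]
    ring

/-- Schur's `Q`-function of a list. -/
def listQ (l : List ℕ) : V := pfBorder qTwo qOne l

/-- One summand of `pfBorder` vanishes by parity; for odd length the border plays the role of the
appended part `0`, since `Q_{(a,0)} = q_a`. -/
theorem schurQ_eq_listQ {n : ℕ} (lam : n.Partition) : schurQ lam = listQ (rowLengths lam) := by
  have hlen : (rowLengths lam).length = lam.parts.card := Multiset.length_sort _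
  rw [schurQ, listQ, pfBorder]
  split_ifs with h
  · have h0 : contr qOne (pf qTwo) (rowLengths lam) = 0 :=
      (contr_congr (fun _ _ => rfl) fun l' hl' => pf_eq_zero_of_odd _ _ (by
        rwa [← hlen, ← hl', Nat.even_add_one, Nat.not_even_iff_odd] at h)).trans
        (contr_zero_right _ _)
    rw [pfaffian_eq_pf, h0, add_zero]
  · rw [← hlen, Nat.not_even_iff_odd] at h
    rw [pfaffian_eq_pf, pf_append_singleton _ _ _ qTwo_zero_right _ h, pf_eq_zero_of_odd _ _ h,
      zero_add]

theorem shift_listQ (l : List ℕ) :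
    shift (listQ l) = Polynomial.C (listQ l) +
      2 * contr qShift (fun x => Polynomial.C (listQ x)) l := by
  have h1 := map_pfBorder (shift : V →+* Polynomial V) qTwo qOne l
  simp only [RingHom.coe_coe, shift_qTwo, shift_qOne] at h1
  have h2 : ∀ x, Polynomial.C (listQ x) = pfBorder (fun m a => Polynomial.C (qTwo m a))
      (fun a => Polynomial.C (qOne a)) x := fun x => map_pfBorder _ _ _ _
  simp only [h2]
  rw [← pfBorder_rank_two]
  exact h1

theorem coeff_contr {R : Type*} [CommRing R] (k : ℕ) (g : ℕ → Polynomial R) (φ : List ℕ → R)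
    (l : List ℕ) : (contr g (fun x => Polynomial.C (φ x)) l).coeff k =
      contr (fun a => (g a).coeff k) φ l := by
  induction l generalizing φ with
  | nil => simp
  | cons m l ih =>
    rw [contr_cons, contr_cons, Polynomial.coeff_sub, Polynomial.coeff_mul_C, ih]

theorem coeff_shift_listQ {k : ℕ} (hk : 0 < k) (l : List ℕ) :
    (shift (listQ l)).coeff k =
      2 * contr (fun a => if k ≤ a then qOne (a - k) else 0) listQ l := by
  rw [shift_listQ, Polynomial.coeff_add, Polynomial.coeff_C, if_neg hk.ne', zero_add, two_mul,
    Polynomial.coeff_add, coeff_contr, two_mul]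
  simp only [coeff_qShift, hk, true_and]

theorem contr_eq_zero {R : Type*} [CommRing R] {g : ℕ → R} {l : List ℕ} (h : ∀ a ∈ l, g a = 0)
    (φ : List ℕ → R) : contr g φ l = 0 := by
  have := contr_mul_left (0 : R) g φ l
  rw [zero_mul] at this
  rw [← this]
  exact contr_congr (fun a ha => by rw [h a ha, zero_mul]) fun _ _ => rfl

theorem coeff_shift_listQ_eq_zero {k : ℕ} (hk : 0 < k) {l : List ℕ} (hl : ∀ a ∈ l, a < k) :
    (shift (listQ l)).coeff k = 0 := by
  rw [coeff_shift_listQ hk, contr_eq_zero fun a ha => if_neg (hl a ha).not_ge, mul_zero]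

/-- The other parts are too small to contribute to `z^m`, so only the removal of `m` remains, with
`q_0 = 1`. -/
theorem coeff_shift_listQ_cons {m : ℕ} (hm : 0 < m) {l : List ℕ} (hl : ∀ a ∈ l, a < m) :
    (shift (listQ (m :: l))).coeff m = 2 * listQ l := by
  rw [coeff_shift_listQ hm, contr_cons, contr_eq_zero fun a ha => if_neg (hl a ha).not_ge,
    if_pos le_rfl, Nat.sub_self, qOne_zero, one_mul, sub_zero]

/-- In `pfBorder_cons` every remainder term has a factor `q_{m+k}`, `k ≥ 1`, whose adjoint kills
`g`. -/
theorem pair_listQ_cons (m : ℕ) (l : List ℕ) {g : V}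
    (hg : ∀ k, m < k → (shift g).coeff k = 0) :
    pair qWeight (listQ (m :: l)) g = pair qWeight (listQ l) ((shift g).coeff m) := by
  rw [listQ, pfBorder_cons, map_add, LinearMap.add_apply, pair_qOne_mul, contr_eq_sum, map_sum,
    LinearMap.sum_apply, Finset.sum_eq_zero, add_zero]
  · rfl
  · intro i _
    rw [qTwo, add_sub_cancel_left, Finset.mul_sum, Finset.mul_sum, Finset.sum_mul, map_sum,
      LinearMap.sum_apply]
    refine Finset.sum_eq_zero fun k hk => ?_
    rw [show ∀ x y u v z : V, x * (2 * (y * (u * v))) * z = u * (x * 2 * y * v * z) by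
      intros; ring, pair_qOne_mul, hg _ (by have := (Finset.mem_Icc.1 hk).1; omega), map_zero]

theorem pair_listQ (l l' : List ℕ) (hl : l.Pairwise (· > ·)) (hl' : l'.Pairwise (· > ·))
    (h0 : ∀ a ∈ l, 0 < a) (h0' : ∀ a ∈ l', 0 < a) :
    pair qWeight (listQ l) (listQ l') = if l = l' then 2 ^ l.length else 0 := by
  have hnil : listQ [] = 1 := pfBorder_nil _ _
  have hshift : ∀ (m : ℕ) (x : List ℕ), (∀ a ∈ x, a ≤ m) → ∀ k, m < k →
      (shift (listQ x)).coeff k = 0 := fun m x hx k hk =>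
    coeff_shift_listQ_eq_zero (by omega) fun a ha => (hx a ha).trans_lt hk
  induction l generalizing l' with
  | nil =>
    cases l' with
    | nil =>
      rw [hnil, if_pos rfl, ← MvPolynomial.C_1, ← MvPolynomial.monomial_zero', pair_monomial_monomial]
      simp [wnorm]
    | cons m' l' =>
      rw [if_neg (by simp), pair_comm, pair_listQ_cons m' l' (hshift m' [] (by simp)),
        coeff_shift_listQ_eq_zero (h0' m' (by simp)) (by simp), map_zero]
  | cons m l ih =>
    cases l' with
    | nil =>
      rw [if_neg (by simp), pair_listQ_cons m l (hshift m [] (by simp)),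
        coeff_shift_listQ_eq_zero (h0 m (by simp)) (by simp), map_zero]
    | cons m' l' =>
      rw [List.pairwise_cons] at hl hl'
      -- The larger first part is moved across: it exceeds every part of the other list, so the
      -- result is zero. Equal first parts cancel and leave a factor `2`.
      rcases lt_trichotomy m m' with h | h | h
      · rw [if_neg (by simp [h.ne]), pair_comm, pair_listQ_cons m' l' (hshift m' _ ?_),
          coeff_shift_listQ_eq_zero (h0' m' (by simp)), map_zero]
        · rintro a (_ | ⟨_, ha⟩)
          · exact h
          · exact (hl.1 a ha).trans h
        · rintro a (_ | ⟨_, ha⟩)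
          · exact h.le
          · exact ((hl.1 a ha).trans h).le
      · subst h
        rw [pair_listQ_cons m l (hshift m _ ?_),
          coeff_shift_listQ_cons (h0 m (by simp)) hl'.1, two_mul, map_add,
          ih l' hl.2 hl'.2 (fun a ha => h0 a (by simp [ha])) fun a ha => h0' a (by simp [ha])]
        · by_cases h : l = l'
          · simp [h, pow_succ]
            ring
          · simp [h]
        · rintro a (_ | ⟨_, ha⟩)
          · exact le_rfl
          · exact (hl'.1 a ha).le
      · rw [if_neg (by simp [h.ne']), pair_listQ_cons m l (hshift m _ ?_),
          coeff_shift_listQ_eq_zero (h0 m (by simp)), map_zero]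
        · rintro a (_ | ⟨_, ha⟩)
          · exact h
          · exact (hl'.1 a ha).trans h
        · rintro a (_ | ⟨_, ha⟩)
          · exact h.le
          · exact ((hl'.1 a ha).trans h).le

end QFunctions

/-! ## Weighted homogeneous polynomials -/

section Homogeneous

/-- The polynomials of weighted degree `n` in the variables satisfying `p`. -/
def homPart (p : ℕ+ → Prop) (n : ℕ) : Submodule ℚ V where
  carrier := {f | ∀ d, f.coeff d ≠ 0 → wdeg d = n ∧ ∀ j ∈ d.support, p j}
  zero_mem' d h := absurd (MvPolynomial.coeff_zero d) h
  add_mem' {f g} hf hg d h := by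
    rw [MvPolynomial.coeff_add] at h
    by_cases h1 : f.coeff d = 0
    · exact hg d fun h2 => h (by rw [h1, h2, add_zero])
    · exact hf d h1
  smul_mem' c f hf d h := by
    rw [MvPolynomial.coeff_smul] at h
    exact hf d (right_ne_zero_of_smul h)

variable {p : ℕ+ → Prop}

theorem homPart_mono {q : ℕ+ → Prop} (h : ∀ j, p j → q j) (n : ℕ) : homPart p n ≤ homPart q n :=
  fun _ hf d hd => ⟨(hf d hd).1, fun j hj => h j ((hf d hd).2 j hj)⟩

theorem one_mem_homPart : (1 : V) ∈ homPart p 0 := by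
  intro d hd
  rw [MvPolynomial.coeff_one] at hd
  have : d = 0 := by
    by_contra h
    exact hd (if_neg fun h' => h h'.symm)
  subst this
  exact ⟨rfl, by simp⟩

theorem mul_mem_homPart {a b : ℕ} {f g : V} (hf : f ∈ homPart p a) (hg : g ∈ homPart p b) :
    f * g ∈ homPart p (a + b) := by
  classical
  intro d hd
  rw [MvPolynomial.coeff_mul] at hd
  obtain ⟨x, hx, hne⟩ := Finset.exists_ne_zero_of_sum_ne_zero hd
  obtain ⟨h1, h2⟩ := hf _ (left_ne_zero_of_mul hne)
  obtain ⟨h3, h4⟩ := hg _ (right_ne_zero_of_mul hne)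
  rw [← Finset.HasAntidiagonal.mem_antidiagonal.1 hx]
  refine ⟨by rw [wdeg_add, h1, h3], fun j hj => ?_⟩
  rcases Finset.mem_union.1 (Finsupp.support_add hj) with h | h
  · exact h2 j h
  · exact h4 j h

theorem tMonomial_mem_homPart {n : ℕ} (ρ : n.Partition) :
    tMonomial ρ ∈ homPart (fun _ => True) n := by
  intro d hd
  rw [tMonomial_eq, MvPolynomial.coeff_monomial] at hd
  have : pexp ρ = d := by
    by_contra h
    exact hd (if_neg h)
  exact ⟨by rw [← this, wdeg_pexp], fun _ _ => trivial⟩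

theorem schurS_mem_homPart {n : ℕ} (lam : n.Partition) :
    schurS lam ∈ homPart (fun _ => True) n :=
  Submodule.sum_mem _ fun ρ _ => by
    rw [← MvPolynomial.smul_eq_C_mul]
    exact Submodule.smul_mem _ _ (tMonomial_mem_homPart ρ)

theorem qOne_mem_homPart (n : ℕ) : qOne n ∈ homPart (fun j => Odd (j : ℕ)) n :=
  fun _ hd => of_coeff_qOne_ne_zero hd

theorem qTwo_mem_homPart (a b : ℕ) : qTwo a b ∈ homPart (fun j => Odd (j : ℕ)) (a + b) := by
  refine Submodule.add_mem _ (mul_mem_homPart (qOne_mem_homPart a) (qOne_mem_homPart b)) ?_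
  rw [two_mul]
  refine (fun h => Submodule.add_mem _ h h) (Submodule.sum_mem _ fun i hi => ?_)
  have hi' := (Finset.mem_Icc.1 hi).2
  have h := mul_mem_homPart (qOne_mem_homPart (a + i)) (qOne_mem_homPart (b - i))
  rw [show a + i + (b - i) = a + b by omega] at h
  rcases neg_one_pow_eq_or V i with h' | h' <;> rw [h']
  · rwa [one_mul]
  · rw [neg_one_mul]
    exact Submodule.neg_mem _ h

theorem contr_mem_homPart {g : ℕ → V} {φ : List ℕ → V} {l : List ℕ} {c c' : ℕ}
    (hg : ∀ a, g a ∈ homPart p (c + a))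
    (hφ : ∀ l', l'.length + 1 = l.length → φ l' ∈ homPart p (c' + l'.sum)) :
    contr g φ l ∈ homPart p (c + c' + l.sum) := by
  induction l generalizing φ c' with
  | nil => exact Submodule.zero_mem _
  | cons m l ih =>
    rw [contr_cons]
    refine Submodule.sub_mem _ ?_ ?_
    · have := mul_mem_homPart (hg m) (hφ l rfl)
      rwa [show c + m + (c' + l.sum) = c + c' + (m :: l).sum by rw [List.sum_cons]; ring] at this
    · have := ih (φ := fun l' => φ (m :: l')) (c' := c' + m) fun l' hl' => by
        have := hφ (m :: l') (by simpa using hl')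
        rwa [List.sum_cons, ← add_assoc] at this
      rwa [show c + (c' + m) + l.sum = c + c' + (m :: l).sum by rw [List.sum_cons]; ring] at this

theorem pf_qTwo_mem_homPart (l : List ℕ) :
    pf qTwo l ∈ homPart (fun j => Odd (j : ℕ)) l.sum := by
  match l with
  | [] =>
    rw [pf_nil]
    exact one_mem_homPart
  | m :: l =>
    rw [pf_cons]
    have := contr_mem_homPart (c' := 0) (l := l) (qTwo_mem_homPart m) (φ := pf qTwo) fun l' hl' => by
      have : l'.length < l.length + 1 := by omega
      rw [zero_add]
      exact pf_qTwo_mem_homPart l'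
    rwa [add_zero, ← List.sum_cons] at this
termination_by l.length

theorem schurQ_mem_homPart {n : ℕ} (lam : n.Partition) :
    schurQ lam ∈ homPart (fun j => Odd (j : ℕ)) n := by
  rw [schurQ_eq_listQ]
  have h : listQ (rowLengths lam) ∈ homPart (fun j => Odd (j : ℕ)) (rowLengths lam).sum := by
    refine Submodule.add_mem _ (pf_qTwo_mem_homPart _) ?_
    have := contr_mem_homPart (c := 0) (c' := 0) (g := qOne) (φ := pf qTwo) (l := rowLengths lam)
      (fun a => by rw [zero_add]; exact qOne_mem_homPart a) fun l' _ => by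
        rw [zero_add]; exact pf_qTwo_mem_homPart l'
    rwa [add_zero, zero_add] at this
  rwa [sum_rowLengths] at h

/-! ### Degrees under `t_j ↦ t_{2j}` and expansions in the `t^(ρ)` -/

theorem doubleVars_monomial (d : ℕ+ →₀ ℕ) (a : ℚ) :
    doubleVars (MvPolynomial.monomial d a) =
      MvPolynomial.monomial (d.mapDomain fun j => 2 * j) a := MvPolynomial.rename_monomial _ _ _

theorem two_mul_pnat_injective : Function.Injective fun j : ℕ+ => 2 * j :=
  fun _ _ h => mul_left_cancel h

theorem wdeg_mapDomain_two_mul (d : ℕ+ →₀ ℕ) :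
    wdeg (d.mapDomain fun j => 2 * j) = 2 * wdeg d := by
  rw [wdeg, Finsupp.sum_mapDomain_index_inj two_mul_pnat_injective, wdeg, Finsupp.sum,
    Finsupp.sum, Finset.mul_sum]
  refine Finset.sum_congr rfl fun j _ => ?_
  push_cast
  ring

theorem even_of_mem_support_mapDomain {d : ℕ+ →₀ ℕ} {j : ℕ+}
    (h : j ∈ (d.mapDomain fun j => 2 * j).support) : Even (j : ℕ) := by
  classical
  obtain ⟨i, -, rfl⟩ := Finset.mem_image.1 (Finsupp.mapDomain_support h)
  simp

theorem doubleVars_mem_homPart {n : ℕ} {f : V} (hf : f ∈ homPart (fun _ => True) n) :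
    doubleVars f ∈ homPart (fun _ => True) (2 * n) := by
  rw [f.as_sum, map_sum]
  refine Submodule.sum_mem _ fun e he => ?_
  rw [doubleVars_monomial]
  intro d hd
  rw [MvPolynomial.coeff_monomial] at hd
  have : e.mapDomain (fun j => 2 * j) = d := by
    by_contra h
    exact hd (if_neg h)
  exact ⟨by rw [← this, wdeg_mapDomain_two_mul, (hf e (MvPolynomial.mem_support_iff.1 he)).1],
    fun _ _ => trivial⟩

theorem compoundW_mem_homPart {n : ℕ} (lam : n.Partition) :
    compoundW lam ∈ homPart (fun _ => True) n := by
  have h := mul_mem_homPart (homPart_mono (fun _ _ => trivial) _ (schurQ_mem_homPart (rPart lam)))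
    (doubleVars_mem_homPart (schurS_mem_homPart (dPart lam)))
  rwa [rParts_sum_add] at h

theorem pair_eq_zero_of_ne {a b : ℕ} (hab : a ≠ b) {f g : V} (w : ℕ+ → ℚ) {q : ℕ+ → Prop}
    (hf : f ∈ homPart p a) (hg : g ∈ homPart q b) : pair w f g = 0 := by
  rw [f.as_sum, map_sum, LinearMap.sum_apply]
  refine Finset.sum_eq_zero fun d hd => ?_
  rw [pair_monomial]
  by_cases h : g.coeff d = 0
  · rw [h, mul_zero, mul_zero]
  · exact absurd ((hf d (MvPolynomial.mem_support_iff.1 hd)).1.symm.trans (hg d h).1) hab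

/-- The coefficient of `t^(ρ)`. -/
def tCoeff {n : ℕ} (f : V) (ρ : n.Partition) : ℚ :=
  f.coeff (pexp ρ) * (pexp ρ).prod fun _ m => (m.factorial : ℚ)

theorem tCoeff_smul_tMonomial {n : ℕ} (f : V) (ρ : n.Partition) :
    tCoeff f ρ • tMonomial ρ = MvPolynomial.monomial (pexp ρ) (f.coeff (pexp ρ)) := by
  rw [tMonomial_eq, MvPolynomial.smul_monomial, tCoeff, smul_eq_mul, mul_assoc, ← Finsupp.prod_mul]
  congr 1
  conv_rhs => rw [← mul_one (MvPolynomial.coeff _ _)]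
  congr 1
  exact Finset.prod_eq_one fun j _ => mul_inv_cancel₀ (by positivity)

theorem eq_sum_tMonomial {n : ℕ} {f : V} (hf : f ∈ homPart p n) :
    f = ∑ ρ : n.Partition, tCoeff f ρ • tMonomial ρ := by
  simp only [tCoeff_smul_tMonomial]
  ext d
  rw [MvPolynomial.coeff_sum]
  simp only [MvPolynomial.coeff_monomial]
  by_cases h : f.coeff d = 0
  · rw [h]
    refine (Finset.sum_eq_zero fun ρ _ => ?_).symm
    split_ifs with h1
    · rw [h1, h]
    · rfl
  · obtain ⟨ρ, rfl⟩ := exists_pexp_eq_of_wdeg (hf d h).1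
    rw [Finset.sum_eq_single ρ, if_pos rfl]
    · exact fun σ _ hσ => if_neg fun h' => hσ (pexp_injective h')
    · simp

theorem pair_sum_tMonomial {n : ℕ} (w : ℕ+ → ℚ) (x y : n.Partition → ℚ) :
    pair w (∑ ρ, x ρ • tMonomial ρ) (∑ ρ, y ρ • tMonomial ρ) = ∑ ρ, x ρ * y ρ * zinv w ρ := by
  rw [LinearMap.map_sum₂]
  refine Finset.sum_congr rfl fun ρ _ => ?_
  rw [map_smul, LinearMap.smul_apply, map_sum, Finset.sum_eq_single ρ]
  · rw [map_smul, pair_tMonomial, if_pos rfl, smul_eq_mul, smul_eq_mul, mul_assoc]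
  · intro σ _ hσ
    rw [map_smul, pair_tMonomial, if_neg hσ.symm, smul_zero]
  · simp

theorem zinv_ne_zero {n : ℕ} {w : ℕ+ → ℚ} (hw : ∀ j, w j ≠ 0) (ρ : n.Partition) :
    zinv w ρ ≠ 0 :=
  Finset.prod_ne_zero_iff.2 fun j _ => div_ne_zero (pow_ne_zero _ (hw j)) (by positivity)

theorem sum_tMonomial_injective {n : ℕ} {x y : n.Partition → ℚ}
    (h : ∑ ρ, x ρ • tMonomial ρ = ∑ ρ, y ρ • tMonomial ρ) : x = y := by
  funext σ
  have h1 := congrArg (fun f => pair (fun _ => 1) f (∑ ρ, (Pi.single σ 1 : n.Partition → ℚ) ρ •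
    tMonomial ρ)) h
  rw [pair_sum_tMonomial, pair_sum_tMonomial, Finset.sum_eq_single σ, Finset.sum_eq_single σ] at h1
  · simpa [zinv_ne_zero (w := fun _ => 1) (by simp)] using h1
  all_goals simp +contextual

/-- Used with `c = 2` and `c = 1/2`, this is where the numbers of parts enter the exponents. -/
theorem zinv_const_mul {n : ℕ} (c : ℚ) (w : ℕ+ → ℚ) (ρ : n.Partition) :
    zinv (fun j => c * w j) ρ = c ^ ρ.parts.card * zinv w ρ := by
  rw [zinv, pexp_prod _ _ (by simp), zinv, pexp_prod _ _ (by simp), card_eq_sum_pexp,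
    ← Finset.prod_pow_eq_pow_sum, ← Finset.prod_mul_distrib]
  refine Finset.prod_congr rfl fun i _ => ?_
  rw [mul_pow, mul_div_assoc]

end Homogeneous

/-! ## The Glaisher bijection -/

section Glaisher

/-- The largest odd divisor. -/
def oddPart (a : ℕ) : ℕ := a / 2 ^ padicValNat 2 a

theorem two_pow_mul_oddPart (a : ℕ) : 2 ^ padicValNat 2 a * oddPart a = a :=
  Nat.mul_div_cancel' pow_padicValNat_dvd

theorem odd_oddPart {a : ℕ} (ha : 0 < a) : Odd (oddPart a) := by
  rw [← Nat.not_even_iff_odd, even_iff_two_dvd]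
  rintro ⟨k, hk⟩
  refine pow_succ_padicValNat_not_dvd (p := 2) ha.ne' ⟨k, ?_⟩
  rw [pow_succ, mul_assoc, ← hk, two_pow_mul_oddPart]

/-- Distinct parts `2^i q` have distinct `i`, so this is the binary expansion of the multiplicity.
Its uniqueness makes the Glaisher map injective. -/
theorem count_glaisherParts {n : ℕ} (lam : n.Partition) (hlam : lam.parts.Nodup) (q : ℕ) :
    (glaisherParts lam).count q =
      ∑ i ∈ (lam.parts.toFinset.filter fun a => oddPart a = q).image (padicValNat 2), 2 ^ i := by
  rw [Finset.sum_image, Finset.sum_filter, glaisherParts, Multiset.count_bind, Finset.sum,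
    Multiset.toFinset_val, hlam.dedup]
  · congr 1
    refine Multiset.map_congr rfl fun a _ => ?_
    rw [Multiset.count_replicate]
    rfl
  · intro a ha b hb hab
    rw [← two_pow_mul_oddPart a, ← two_pow_mul_oddPart b, hab, (Finset.mem_filter.1 ha).2,
      (Finset.mem_filter.1 hb).2]

/-- The partitions into odd parts. -/
abbrev OddPartition (n : ℕ) : Type := {ρ : n.Partition // ρ ∈ Nat.Partition.odds n}

/-- The Glaisher map. -/
def glaisherMap (n : ℕ) (lam : StrictPart n) : OddPartition n :=
  ⟨glaisher lam.1, by
    simp only [Nat.Partition.odds, Nat.Partition.restricted, Finset.mem_filter, Finset.mem_univ,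
      true_and, Nat.not_even_iff_odd]
    intro i hi
    obtain ⟨a, ha, hia⟩ := Multiset.mem_bind.1 hi
    rw [Multiset.eq_of_mem_replicate hia]
    exact odd_oddPart (lam.1.parts_pos ha)⟩

theorem glaisherMap_injective (n : ℕ) : Function.Injective (glaisherMap n) := by
  intro lam mu h
  have h1 : glaisherParts lam.1 = glaisherParts mu.1 :=
    congrArg (fun x : OddPartition n => x.1.parts) h
  have h2 : ∀ q, (lam.1.parts.toFinset.filter fun a => oddPart a = q).image (padicValNat 2) =
      (mu.1.parts.toFinset.filter fun a => oddPart a = q).image (padicValNat 2) := fun q => by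
    refine Finset.geomSum_injective le_rfl ?_
    dsimp only
    rw [← count_glaisherParts _ lam.2, ← count_glaisherParts _ mu.2, h1]
  have h3 : ∀ (nu nu' : StrictPart n), (∀ q,
      (nu.1.parts.toFinset.filter fun a => oddPart a = q).image (padicValNat 2) =
      (nu'.1.parts.toFinset.filter fun a => oddPart a = q).image (padicValNat 2)) →
      ∀ a ∈ nu.1.parts, a ∈ nu'.1.parts := by
    intro nu nu' hq a ha
    have h4 : padicValNat 2 a ∈
        (nu.1.parts.toFinset.filter fun b => oddPart b = oddPart a).image (padicValNat 2) :=
      Finset.mem_image.2 ⟨a, Finset.mem_filter.2 ⟨Multiset.mem_toFinset.2 ha, rfl⟩, rfl⟩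
    rw [hq] at h4
    obtain ⟨b, hb, hab⟩ := Finset.mem_image.1 h4
    obtain ⟨hb1, hb2⟩ := Finset.mem_filter.1 hb
    rw [← two_pow_mul_oddPart a, ← hab, ← hb2, two_pow_mul_oddPart]
    exact Multiset.mem_toFinset.1 hb1
  exact Subtype.ext (Nat.Partition.ext ((Multiset.Nodup.ext lam.2 mu.2).2 fun a =>
    ⟨h3 lam mu h2 a, h3 mu lam (fun q => (h2 q).symm) a⟩))

/-- Surjectivity follows from Euler's theorem that odd and strict partitions are equinumerous. -/
theorem glaisherMap_bijective (n : ℕ) : Function.Bijective (glaisherMap n) := by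
  rw [Fintype.bijective_iff_injective_and_card]
  refine ⟨glaisherMap_injective n, ?_⟩
  rw [Fintype.card_coe, Nat.Partition.card_odds_eq_card_distincts, Nat.Partition.distincts,
    ← Fintype.card_subtype]

/-- The Glaisher bijection from strict to odd partitions. -/
def glaisherEquiv (n : ℕ) : StrictPart n ≃ OddPartition n :=
  Equiv.ofBijective _ (glaisherMap_bijective n)

end Glaisher

/-! ## Gram determinants -/

section Gram

/-- The weights of the Hall form. -/
def hallWeight (j : ℕ+) : ℚ := ((j : ℕ) : ℚ)⁻¹

/-- The Gram matrix of the `Q`-functions. -/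
def gramQ (w : ℕ+ → ℚ) (n : ℕ) : Matrix (StrictPart n) (StrictPart n) ℚ :=
  Matrix.of fun lam mu => pair w (schurQ lam.1) (schurQ mu.1)

/-- The expansion of the `Q`-functions, with columns indexed through the Glaisher bijection. -/
def coeffQ (n : ℕ) : Matrix (StrictPart n) (StrictPart n) ℚ :=
  Matrix.of fun lam mu => tCoeff (schurQ lam.1) (glaisherEquiv n mu).1

/-- Only odd `ρ` occur in `Q_λ`, and indexing them through the Glaisher bijection makes the
coefficient matrix square, so that determinants can be taken factor by factor. -/
theorem gramQ_eq (w : ℕ+ → ℚ) (n : ℕ) :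
    gramQ w n = coeffQ n * Matrix.diagonal (fun mu => zinv w (glaisherEquiv n mu).1) *
      (coeffQ n)ᵀ := by
  ext lam mu
  rw [gramQ, Matrix.of_apply, eq_sum_tMonomial (schurQ_mem_homPart lam.1),
    eq_sum_tMonomial (schurQ_mem_homPart mu.1), pair_sum_tMonomial, Matrix.mul_apply]
  simp only [Matrix.mul_diagonal, Matrix.transpose_apply, coeffQ, Matrix.of_apply]
  rw [Equiv.sum_comp (glaisherEquiv n) fun ρ : OddPartition n => tCoeff (schurQ lam.1) ρ.1 *
    zinv w ρ.1 * tCoeff (schurQ mu.1) ρ.1,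
    Finset.sum_coe_sort (Nat.Partition.odds n) fun ρ => tCoeff (schurQ lam.1) ρ *
    zinv w ρ * tCoeff (schurQ mu.1) ρ]
  symm
  refine (Finset.sum_subset (Finset.subset_univ _) fun ρ _ hρ => ?_).trans
    (Finset.sum_congr rfl fun ρ _ => by ring)
  have h : tCoeff (schurQ lam.1) ρ = 0 := by
    rw [tCoeff, mul_eq_zero]
    by_contra! h
    exact hρ ((isOddExp_pexp ρ).1 (schurQ_mem_homPart lam.1 _ h.1).2)
  rw [h, zero_mul, zero_mul]

theorem pairwise_rowLengths_of_nodup {n : ℕ} {lam : n.Partition} (h : lam.parts.Nodup) :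
    (rowLengths lam).Pairwise (· > ·) := by
  have h2 : (rowLengths lam).Nodup := by
    rw [← Multiset.coe_nodup, rowLengths, Multiset.sort_eq]
    exact h
  exact ((pairwise_rowLengths lam).and h2).imp fun h => lt_of_le_of_ne h.1 h.2.symm

theorem gramQ_qWeight (n : ℕ) :
    gramQ qWeight n = Matrix.diagonal fun lam => (2 : ℚ) ^ lam.1.parts.card := by
  ext lam mu
  rw [gramQ, Matrix.of_apply, schurQ_eq_listQ, schurQ_eq_listQ,
    pair_listQ _ _ (pairwise_rowLengths_of_nodup lam.2) (pairwise_rowLengths_of_nodup mu.2)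
      (fun a => pos_of_mem_rowLengths _) fun a => pos_of_mem_rowLengths _, Matrix.diagonal_apply]
  have h : rowLengths lam.1 = rowLengths mu.1 ↔ lam = mu := by
    refine ⟨fun h => Subtype.ext (Nat.Partition.ext ?_), fun h => by rw [h]⟩
    rw [← Multiset.sort_eq lam.1.parts (· ≥ ·), ← Multiset.sort_eq mu.1.parts (· ≥ ·)]
    exact congrArg _ h
  rw [show (rowLengths lam.1).length = lam.1.parts.card from Multiset.length_sort _]
  simp only [h]

/-- The Gram matrices for the weights `1/j` and `2/j` share the factor `coeffQ`. The second is
diagonal, and their determinants differ by the product of `2^{ℓ(ρ)}` over odd `ρ`. -/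
theorem det_gramQ (n : ℕ) :
    (gramQ hallWeight n).det =
      2 ^ (∑ lam : StrictPart n, ((len lam.1 : ℤ) - (len (glaisher lam.1) : ℤ))) := by
  have h1 := congrArg Matrix.det (gramQ_qWeight n)
  have hq : qWeight = fun j => 2 * hallWeight j := by
    funext j
    rw [qWeight, hallWeight, div_eq_mul_inv]
  rw [gramQ_eq, Matrix.det_mul, Matrix.det_mul, Matrix.det_diagonal, Matrix.det_diagonal,
    Matrix.det_transpose, hq] at h1
  simp only [zinv_const_mul, Finset.prod_mul_distrib] at h1
  rw [gramQ_eq, Matrix.det_mul, Matrix.det_mul, Matrix.det_diagonal, Matrix.det_transpose,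
    Finset.sum_sub_distrib, zpow_sub₀ two_ne_zero, eq_div_iff (by positivity)]
  rw [Finset.prod_pow_eq_pow_sum, Finset.prod_pow_eq_pow_sum] at h1
  rw [← Nat.cast_sum, ← Nat.cast_sum, zpow_natCast, zpow_natCast]
  refine Eq.trans ?_ h1
  have : ∀ mu : StrictPart n, ((glaisherEquiv n mu).1.parts.card) = len (glaisher mu.1) :=
    fun mu => rfl
  simp only [this]
  ring

/-- The table of the irreducible characters. -/
def charTable (n : ℕ) : Matrix n.Partition n.Partition ℚ :=
  Matrix.of fun lam ρ => spechtCharacter lam (classRep ρ)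

theorem charTable_orthonormal (n : ℕ) :
    charTable n * Matrix.diagonal (zinv hallWeight) * (charTable n)ᵀ = 1 := by
  ext lam mu
  rw [Matrix.mul_apply, Matrix.one_apply, ← sum_spechtCharacter_mul_zinv]
  simp only [Matrix.mul_diagonal, Matrix.transpose_apply, charTable, Matrix.of_apply]
  exact Finset.sum_congr rfl fun ρ _ => mul_right_comm _ _ _

theorem schurS_eq {n : ℕ} (lam : n.Partition) :
    schurS lam = ∑ ρ, charTable n lam ρ • tMonomial ρ :=
  Finset.sum_congr rfl fun _ _ => (MvPolynomial.smul_eq_C_mul _ _).symm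

/-- The Gram matrix of the functions `S_λ(t')`. -/
def gramS (n : ℕ) : Matrix n.Partition n.Partition ℚ :=
  Matrix.of fun lam mu =>
    pair hallWeight (doubleVars (schurS lam)) (doubleVars (schurS mu))

theorem pair_doubleVars (w : ℕ+ → ℚ) (f g : V) :
    pair w (doubleVars f) (doubleVars g) = pair (fun j => w (2 * j)) f g := by
  induction f using MvPolynomial.induction_on' with
  | monomial d a =>
    induction g using MvPolynomial.induction_on' with
    | monomial e b =>
      rw [doubleVars_monomial, doubleVars_monomial, pair_monomial_monomial, pair_monomial_monomial]
      have h : wnorm w (d.mapDomain fun j => 2 * j) = wnorm (fun j => w (2 * j)) d :=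
        Finsupp.prod_mapDomain_index_inj two_mul_pnat_injective
      rw [h]
      simp only [(Finsupp.mapDomain_injective two_mul_pnat_injective).eq_iff]
    | add p q hp hq => rw [map_add, map_add, hp, hq, map_add]
  | add p q hp hq =>
    rw [map_add, map_add, LinearMap.add_apply, hp, hq, map_add, LinearMap.add_apply]

theorem gramS_eq (n : ℕ) :
    gramS n = charTable n *
      Matrix.diagonal (fun ρ => ((2 : ℚ)⁻¹) ^ ρ.parts.card * zinv hallWeight ρ) *
        (charTable n)ᵀ := by
  ext lam mu
  have hw : (fun j => hallWeight (2 * j)) = fun j => (2 : ℚ)⁻¹ * hallWeight j := by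
    funext j
    simp [hallWeight, mul_comm]
  rw [gramS, Matrix.of_apply, pair_doubleVars, schurS_eq, schurS_eq, pair_sum_tMonomial,
    Matrix.mul_apply, hw]
  simp only [Matrix.mul_diagonal, Matrix.transpose_apply, zinv_const_mul]
  exact Finset.sum_congr rfl fun ρ _ => mul_right_comm _ _ _

theorem det_gramS (n : ℕ) :
    (gramS n).det = 2 ^ (-∑ lam : n.Partition, (len lam : ℤ)) := by
  have h1 := congrArg Matrix.det (charTable_orthonormal n)
  rw [Matrix.det_mul, Matrix.det_mul, Matrix.det_diagonal, Matrix.det_transpose,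
    Matrix.det_one] at h1
  rw [gramS_eq, Matrix.det_mul, Matrix.det_mul, Matrix.det_diagonal, Matrix.det_transpose,
    Finset.prod_mul_distrib, Finset.prod_pow_eq_pow_sum, zpow_neg, ← Nat.cast_sum, zpow_natCast,
    ← inv_pow]
  rw [mul_left_comm, mul_assoc, h1, mul_one]
  rfl

/-! ### Separation of odd and even variables -/

theorem wnorm_add (w : ℕ+ → ℚ) {d e : ℕ+ →₀ ℕ} (h : Disjoint d.support e.support) :
    wnorm w (d + e) = wnorm w d * wnorm w e := Finsupp.prod_add_index_of_disjoint h _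

theorem disjoint_odd_double {d : ℕ+ →₀ ℕ} (hd : IsOddExp d) (e : ℕ+ →₀ ℕ) :
    Disjoint d.support (e.mapDomain fun j => 2 * j).support :=
  Finset.disjoint_left.2 fun j hj hj' =>
    Nat.not_even_iff_odd.2 (hd j hj) (even_of_mem_support_mapDomain hj')

theorem odd_add_double_eq_iff {d d' : ℕ+ →₀ ℕ} (hd : IsOddExp d) (hd' : IsOddExp d')
    (e e' : ℕ+ →₀ ℕ) :
    d + e.mapDomain (fun j => 2 * j) = d' + e'.mapDomain (fun j => 2 * j) ↔
      d = d' ∧ e.mapDomain (fun j => 2 * j) = e'.mapDomain (fun j => 2 * j) := by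
  refine ⟨fun h => ?_, fun h => by rw [h.1, h.2]⟩
  have h1 : d = d' := by
    ext j
    have hj := DFunLike.congr_fun h j
    rw [Finsupp.add_apply, Finsupp.add_apply] at hj
    rcases Nat.even_or_odd (j : ℕ) with he | ho
    · rw [Finsupp.notMem_support_iff.1 fun h => Nat.not_odd_iff_even.2 he (hd j h),
        Finsupp.notMem_support_iff.1 fun h => Nat.not_odd_iff_even.2 he (hd' j h)]
    · have h0 : ∀ x : ℕ+ →₀ ℕ, (x.mapDomain fun j => 2 * j) j = 0 := fun x =>
        Finsupp.notMem_support_iff.1 fun h =>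
          Nat.not_even_iff_odd.2 ho (even_of_mem_support_mapDomain h)
      rwa [h0, h0, add_zero, add_zero] at hj
  exact ⟨h1, add_left_cancel (h1 ▸ h)⟩

/-- A monomial determines its odd and even parts, and norms multiply over disjoint sets of
variables. -/
theorem pair_mul_doubleVars (w : ℕ+ → ℚ) {a b : ℕ} {f g : V}
    (hf : f ∈ homPart (fun j => Odd (j : ℕ)) a) (hg : g ∈ homPart (fun j => Odd (j : ℕ)) b)
    (u v : V) :
    pair w (f * doubleVars u) (g * doubleVars v) =
      pair w f g * pair w (doubleVars u) (doubleVars v) := by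
  induction u using MvPolynomial.induction_on' with
  | monomial e x =>
    induction v using MvPolynomial.induction_on' with
    | monomial e' y =>
      rw [f.as_sum, g.as_sum, doubleVars_monomial, doubleVars_monomial]
      simp only [Finset.sum_mul, map_sum, LinearMap.sum_apply]
      rw [Finset.sum_comm]
      conv_rhs => rw [Finset.sum_comm]
      refine Finset.sum_congr rfl fun d hd => Finset.sum_congr rfl fun d' hd' => ?_
      have ho := (hf d (MvPolynomial.mem_support_iff.1 hd)).2
      have ho' := (hg d' (MvPolynomial.mem_support_iff.1 hd')).2
      rw [MvPolynomial.monomial_mul, MvPolynomial.monomial_mul, pair_monomial_monomial,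
        pair_monomial_monomial, pair_monomial_monomial, wnorm_add w (disjoint_odd_double ho e)]
      simp only [odd_add_double_eq_iff ho ho']
      split_ifs with h1 h2 h3 h3 h4 h5
      · ring
      all_goals first | (exfalso; tauto) | simp
    | add p q hp hq => rw [map_add, mul_add, map_add, map_add, hp, hq, mul_add]
  | add p q hp hq =>
    rw [map_add, mul_add, map_add, map_add, LinearMap.add_apply, LinearMap.add_apply, hp, hq,
      mul_add]

end Gram

/-! ## The pairs `(λ^r, λ^d)` -/

section Pairs

variable {n : ℕ}

theorem count_rParts (lam : n.Partition) (i : ℕ) :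
    (rParts lam).count i = lam.parts.count i % 2 := by
  rw [rParts, Multiset.count_filter]
  split_ifs with h
  · rw [Multiset.count_eq_one_of_mem (Multiset.nodup_dedup _)
      (Multiset.mem_dedup.2 (Multiset.count_pos.1 h.pos)), Nat.odd_iff.1 h]
  · rw [Nat.even_iff.1 (Nat.not_odd_iff_even.1 h)]

theorem count_dParts (lam : n.Partition) (i : ℕ) :
    (dParts lam).count i = lam.parts.count i / 2 := by
  rw [dParts, Multiset.count_sum']
  simp only [Multiset.count_replicate]
  rw [Finset.sum_ite_eq' lam.parts.toFinset i]
  split_ifs with h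
  · rfl
  · rw [Multiset.count_eq_zero_of_notMem fun h' => h (Multiset.mem_toFinset.2 h'), Nat.zero_div]

theorem rParts_nodup (lam : n.Partition) : (rParts lam).Nodup :=
  (Multiset.nodup_dedup _).filter _

variable {n₀ n₁ : ℕ}

/-- The strict partition `λ^r` of `n₀` for `λ ∈ P(n₀, n₁)`. -/
def rStrict (lam : PairPart n n₀ n₁) : StrictPart n₀ :=
  ⟨⟨rParts lam.1, (rPart lam.1).parts_pos, lam.2.1⟩, rParts_nodup lam.1⟩

/-- The partition `λ^d` of `n₁` for `λ ∈ P(n₀, n₁)`. -/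
def dPartition (lam : PairPart n n₀ n₁) : n₁.Partition :=
  ⟨dParts lam.1, (dPart lam.1).parts_pos, lam.2.2⟩

theorem pairMap_bijective (h : n₀ + 2 * n₁ = n) :
    Function.Bijective fun lam : PairPart n n₀ n₁ => (rStrict lam, dPartition lam) := by
  constructor
  · intro lam mu hlm
    obtain ⟨h1, h2⟩ := Prod.mk.inj hlm
    have h3 : rParts lam.1 = rParts mu.1 := congrArg (fun x : StrictPart n₀ => x.1.parts) h1
    have h4 : dParts lam.1 = dParts mu.1 := congrArg Nat.Partition.parts h2
    refine Subtype.ext (Nat.Partition.ext (Multiset.ext.2 fun i => ?_))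
    rw [← Nat.mod_add_div (lam.1.parts.count i) 2, ← count_rParts, ← count_dParts, h3, h4,
      count_rParts, count_dParts, Nat.mod_add_div]
  · rintro ⟨mu, nu⟩
    let lam : n.Partition := ⟨mu.1.parts + (nu.parts + nu.parts), fun {i} hi => by
      rcases Multiset.mem_add.1 hi with hi | hi
      · exact mu.1.parts_pos hi
      · rcases Multiset.mem_add.1 hi with hi | hi <;> exact nu.parts_pos hi, by
      rw [Multiset.sum_add, Multiset.sum_add, mu.1.parts_sum, nu.parts_sum]; omega⟩
    have hc : ∀ i, lam.parts.count i = mu.1.parts.count i + 2 * nu.parts.count i := fun i => by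
      change Multiset.count i (mu.1.parts + (nu.parts + nu.parts)) = _
      rw [Multiset.count_add, Multiset.count_add]
      ring
    have hr : rParts lam = mu.1.parts := Multiset.ext.2 fun i => by
      have := Multiset.nodup_iff_count_le_one.1 mu.2 i
      rw [count_rParts, hc]
      omega
    have hd : dParts lam = nu.parts := Multiset.ext.2 fun i => by
      have := Multiset.nodup_iff_count_le_one.1 mu.2 i
      rw [count_dParts, hc]
      omega
    refine ⟨⟨lam, by rw [hr, mu.1.parts_sum], by rw [hd, nu.parts_sum]⟩, ?_⟩
    exact Prod.ext (Subtype.ext (Nat.Partition.ext hr)) (Nat.Partition.ext hd)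

/-- The bijection `λ ↦ (λ^r, λ^d)`. -/
def pairEquiv (h : n₀ + 2 * n₁ = n) : PairPart n n₀ n₁ ≃ StrictPart n₀ × n₁.Partition :=
  Equiv.ofBijective _ (pairMap_bijective h)

theorem schurQ_congr {m : ℕ} {lam : n.Partition} {mu : m.Partition} (h : lam.parts = mu.parts) :
    schurQ lam = schurQ mu := by
  simp only [schurQ, rowLengths, h]

theorem eq_of_parts_eq {m : ℕ} {lam : n.Partition} {mu : m.Partition}
    (h : lam.parts = mu.parts) : n = m := by
  rw [← lam.parts_sum, h, mu.parts_sum]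

theorem schurS_congr {m : ℕ} {lam : n.Partition} {mu : m.Partition} (h : lam.parts = mu.parts) :
    schurS lam = schurS mu := by
  obtain rfl := eq_of_parts_eq h
  rw [Nat.Partition.ext h]

theorem len_glaisher_congr {m : ℕ} {lam : n.Partition} {mu : m.Partition}
    (h : lam.parts = mu.parts) : len (glaisher lam) = len (glaisher mu) := by
  simp only [len, glaisher, glaisherParts, h]

theorem compoundW_eq (lam : PairPart n n₀ n₁) :
    compoundW lam.1 = schurQ (rStrict lam).1 * doubleVars (schurS (dPartition lam)) := by
  rw [compoundW, schurQ_congr (lam := rPart lam.1) (mu := (rStrict lam).1) rfl,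
    schurS_congr (lam := dPart lam.1) (mu := dPartition lam) rfl]

theorem pair_compoundW (lam mu : PairPart n n₀ n₁) :
    pair hallWeight (compoundW lam.1) (compoundW mu.1) =
      gramQ hallWeight n₀ (rStrict lam) (rStrict mu) *
        gramS n₁ (dPartition lam) (dPartition mu) := by
  rw [compoundW_eq, compoundW_eq, pair_mul_doubleVars _ (schurQ_mem_homPart _)
    (schurQ_mem_homPart _)]
  rfl

theorem pair_compoundW_eq_zero {lam mu : n.Partition} (h : (rParts lam).sum ≠ (rParts mu).sum) :
    pair hallWeight (compoundW lam) (compoundW mu) = 0 := by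
  rw [compoundW, compoundW, pair_mul_doubleVars _ (schurQ_mem_homPart _) (schurQ_mem_homPart _),
    pair_eq_zero_of_ne h _ (schurQ_mem_homPart _) (schurQ_mem_homPart _), zero_mul]

/-- The Gram matrix of the compound basis. -/
def gramW (n : ℕ) : Matrix n.Partition n.Partition ℚ :=
  Matrix.of fun lam mu => pair hallWeight (compoundW lam) (compoundW mu)

/-- A diagonal block of the Gram matrix of the compound basis. -/
def gramBlock (n n₀ n₁ : ℕ) : Matrix (PairPart n n₀ n₁) (PairPart n n₀ n₁) ℚ :=
  (gramW n).submatrix Subtype.val Subtype.val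

/-- The block is a Kronecker product. Each determinant is raised to the size of the other factor,
which is what summing over all pairs `(λ^r, λ^d)` produces. -/
theorem det_gramBlock (h : n₀ + 2 * n₁ = n) :
    (gramBlock n n₀ n₁).det = 2 ^ (-∑ lam : PairPart n n₀ n₁,
      ((len (glaisher (rPart lam.1)) : ℤ) - (len (rPart lam.1) : ℤ) +
        (len (dPart lam.1) : ℤ))) := by
  have h1 : gramBlock n n₀ n₁ = (Matrix.kroneckerMap (· * ·) (gramQ hallWeight n₀)
      (gramS n₁)).submatrix (pairEquiv h) (pairEquiv h) := by
    ext lam mu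
    exact pair_compoundW lam mu
  have h2 : ∑ lam : PairPart n n₀ n₁,
      ((len (glaisher (rPart lam.1)) : ℤ) - (len (rPart lam.1) : ℤ) + (len (dPart lam.1) : ℤ)) =
      ∑ x : StrictPart n₀ × n₁.Partition,
        ((len (glaisher x.1.1) : ℤ) - (len x.1.1 : ℤ) + (len x.2 : ℤ)) := by
    refine Fintype.sum_equiv (pairEquiv h) _ _ fun lam => ?_
    rw [len_glaisher_congr (mu := (pairEquiv h lam).1.1) rfl]
    rfl
  rw [h1, Matrix.det_submatrix_equiv_self, Matrix.det_kronecker, det_gramQ, det_gramS, h2,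
    ← zpow_natCast, ← zpow_natCast, ← zpow_mul, ← zpow_mul, ← zpow_add₀ two_ne_zero]
  congr 1
  rw [Fintype.sum_prod_type]
  simp only [Finset.sum_add_distrib, Finset.sum_sub_distrib, Finset.sum_const, Finset.card_univ,
    nsmul_eq_mul, ← Finset.mul_sum]
  ring

theorem det_gramBlock_ne_zero (h : n₀ + 2 * n₁ = n) : (gramBlock n n₀ n₁).det ≠ 0 := by
  rw [det_gramBlock h]
  exact zpow_ne_zero _ two_ne_zero

theorem sum_pairPart (h : n₀ + 2 * n₁ = n) {f : n.Partition → ℚ}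
    (hf : ∀ lam, (rParts lam).sum ≠ n₀ → f lam = 0) :
    ∑ lam : PairPart n n₀ n₁, f lam.1 = ∑ lam, f lam := by
  rw [← Finset.sum_subtype (Finset.univ.filter fun lam : n.Partition =>
    (rParts lam).sum = n₀ ∧ (dParts lam).sum = n₁) (by simp) f]
  refine Finset.sum_filter_of_ne fun lam _ hlam => ?_
  have h1 : (rParts lam).sum = n₀ := by
    by_contra h'
    exact hlam (hf lam h')
  have h2 := rParts_sum_add lam
  exact ⟨h1, by omega⟩

/-- A kernel vector, restricted to the block of one of its nonzero entries, would be a nonzero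
kernel vector of that block. -/
theorem det_gramW_ne_zero (n : ℕ) : (gramW n).det ≠ 0 := by
  intro h0
  obtain ⟨v, hv, hGv⟩ := Matrix.exists_mulVec_eq_zero_iff.2 h0
  obtain ⟨lam, hlam⟩ := Function.ne_iff.1 hv
  have h := rParts_sum_add lam
  refine det_gramBlock_ne_zero h (Matrix.exists_mulVec_eq_zero_iff.1
    ⟨fun mu => v mu.1, fun h' => hlam (congrFun h' ⟨lam, rfl, rfl⟩), ?_⟩)
  funext mu
  have h1 := congrFun hGv mu.1
  refine Eq.trans ?_ h1
  refine sum_pairPart h (f := fun nu => gramW n mu.1 nu * v nu) fun nu hnu => ?_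
  rw [gramW, Matrix.of_apply, pair_compoundW_eq_zero (by rw [mu.2.1]; exact hnu.symm), zero_mul]

end Pairs

/-! ## The substitution `t_{2j} ↦ 0` -/

section KillEven

theorem killEven_of_mem_homPart {n : ℕ} {f : V} (hf : f ∈ homPart (fun j => Odd (j : ℕ)) n) :
    killEven f = f := by
  conv_lhs => rw [f.as_sum, map_sum]
  conv_rhs => rw [f.as_sum]
  refine Finset.sum_congr rfl fun d hd => ?_
  rw [killEven, MvPolynomial.aeval_monomial, MvPolynomial.monomial_eq]
  congr 1
  refine Finsupp.prod_congr fun j hj => ?_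
  rw [if_neg (Nat.not_even_iff_odd.2 ((hf d (MvPolynomial.mem_support_iff.1 hd)).2 j hj))]

theorem killEven_doubleVars (f : V) :
    killEven (doubleVars f) = MvPolynomial.C (f.coeff 0) := by
  have : (killEven.comp doubleVars : V →ₐ[ℚ] V) = MvPolynomial.aeval (fun _ => 0) := by
    refine MvPolynomial.algHom_ext fun j => ?_
    simp [killEven, doubleVars]
  have h := AlgHom.congr_fun this f
  rw [MvPolynomial.aeval_zero'] at h
  exact h

theorem coeff_zero_schurS {n : ℕ} (hn : n ≠ 0) (lam : n.Partition) : (schurS lam).coeff 0 = 0 := by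
  by_contra h
  exact hn (schurS_mem_homPart lam 0 h).1.symm

/-- Orthonormality says that the only character value squares to `1`, and as a dimension it is not
negative. -/
theorem schurS_of_eq_zero {n : ℕ} (hn : n = 0) (lam : n.Partition) : schurS lam = 1 := by
  subst hn
  have ht : ∀ ρ : Nat.Partition 0, tMonomial ρ = 1 := fun ρ => by simp [tMonomial]
  have h1 := sum_spechtCharacter_mul_zinv lam lam
  have hz : ∀ ρ : Nat.Partition 0, zinv (fun j => ((j : ℕ) : ℚ)⁻¹) ρ = 1 := fun ρ => by
    rw [zinv, pexp_prod _ _ (by simp)]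
    simp
  have hpos : 0 ≤ spechtCharacter lam (classRep lam) := by
    rw [Subsingleton.elim (classRep lam) 1, spechtCharacter, map_one, map_one, LinearMap.trace_one]
    positivity
  rw [Fintype.sum_unique, if_pos rfl, hz, mul_one, Subsingleton.elim default lam] at h1
  rw [schurS, Fintype.sum_unique, ht, mul_one, Subsingleton.elim default lam]
  rw [(mul_self_eq_one_iff.1 h1).resolve_right (by intro h; rw [h] at hpos; norm_num at hpos),
    map_one]

theorem killEven_compoundW {n : ℕ} (lam : n.Partition) :
    killEven (compoundW lam) = if lam.parts.Nodup then schurQ lam else 0 := by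
  rw [compoundW, map_mul, killEven_of_mem_homPart (schurQ_mem_homPart _), killEven_doubleVars]
  split_ifs with h
  · rw [schurS_of_eq_zero ((dParts_sum_eq_zero_iff lam).2 h), MvPolynomial.coeff_one, if_pos rfl,
      map_one, mul_one]
    refine schurQ_congr (Multiset.ext.2 fun i => ?_)
    have := Multiset.nodup_iff_count_le_one.1 h i
    change (rParts lam).count i = _
    rw [count_rParts, Nat.mod_eq_of_lt (by omega)]
  · rw [coeff_zero_schurS fun h' => h ((dParts_sum_eq_zero_iff lam).1 h'), map_zero, mul_zero]

end KillEven

/-! ## The transition matrix -/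

section Transition

variable {n : ℕ}

/-- The expansion of the compound basis in the `t^(ρ)`. -/
def coeffW (n : ℕ) : Matrix n.Partition n.Partition ℚ :=
  Matrix.of fun lam ρ => tCoeff (compoundW lam) ρ

theorem compoundW_eq_sum (lam : n.Partition) :
    compoundW lam = ∑ ρ, coeffW n lam ρ • tMonomial ρ :=
  eq_sum_tMonomial (compoundW_mem_homPart lam)

theorem gramW_eq (n : ℕ) :
    gramW n = coeffW n * Matrix.diagonal (zinv hallWeight) * (coeffW n)ᵀ := by
  ext lam mu
  rw [gramW, Matrix.of_apply, compoundW_eq_sum, compoundW_eq_sum, pair_sum_tMonomial,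
    Matrix.mul_apply]
  simp only [Matrix.mul_diagonal, Matrix.transpose_apply]
  exact Finset.sum_congr rfl fun ρ _ => mul_right_comm _ _ _

theorem isUnit_det_coeffW (n : ℕ) : IsUnit (coeffW n).det := by
  have h := det_gramW_ne_zero n
  rw [gramW_eq, Matrix.det_mul] at h
  have h2 := left_ne_zero_of_mul h
  rw [Matrix.det_mul] at h2
  exact (left_ne_zero_of_mul h2).isUnit

theorem isTransitionMatrix_iff (A : Matrix n.Partition n.Partition ℚ) :
    IsTransitionMatrix A ↔ charTable n = A * coeffW n := by
  have h : ∀ lam, ∑ mu, A lam mu • compoundW mu = ∑ ρ, (A * coeffW n) lam ρ • tMonomial ρ := by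
    intro lam
    simp only [compoundW_eq_sum, Finset.smul_sum, smul_smul]
    rw [Finset.sum_comm]
    simp only [Matrix.mul_apply, Finset.sum_smul]
  constructor
  · intro hA
    ext lam ρ
    have := hA lam
    rw [h, schurS_eq] at this
    exact congrFun (sum_tMonomial_injective this) ρ
  · intro hA lam
    rw [h, schurS_eq, ← hA]

theorem gramW_mul_eq_one {A : Matrix n.Partition n.Partition ℚ} (hA : IsTransitionMatrix A) :
    gramW n * (Aᵀ * A) = 1 := by
  rw [isTransitionMatrix_iff] at hA
  have h1 := charTable_orthonormal n
  rw [Matrix.mul_assoc, hA, Matrix.transpose_mul] at h1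
  -- Orthonormality reads `A · Gram(W) · ᵗA = 1`; for square matrices `A` may be moved to the other
  -- end.
  have h2 : (coeffW n * (Matrix.diagonal (zinv hallWeight) * ((coeffW n)ᵀ * Aᵀ))) * A = 1 := by
    rw [mul_eq_one_comm, ← Matrix.mul_assoc]
    exact h1
  rw [← h2, gramW_eq]
  simp only [Matrix.mul_assoc]

theorem transpose_mul_self_eq_zero {A : Matrix n.Partition n.Partition ℚ}
    (hA : IsTransitionMatrix A) {lam mu : n.Partition}
    (h : (rParts lam).sum ≠ (rParts mu).sum) : (Aᵀ * A) lam mu = 0 := by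
  set N := Aᵀ * A
  have h1 : gramW n * N = 1 := gramW_mul_eq_one hA
  have h2 : N * gramW n = 1 := mul_eq_one_comm.1 h1
  -- `D` labels the blocks by `|λ^r|`. It commutes with `Gram(W)`, hence with the inverse `N`, whose
  -- entries between different labels must vanish.
  let D : Matrix n.Partition n.Partition ℚ := Matrix.diagonal fun nu => ((rParts nu).sum : ℚ)
  have h3 : gramW n * D = D * gramW n := by
    ext x y
    rw [Matrix.mul_diagonal, Matrix.diagonal_mul, mul_comm]
    by_cases hxy : (rParts x).sum = (rParts y).sum
    · rw [hxy]
    · rw [gramW, Matrix.of_apply, pair_compoundW_eq_zero hxy, mul_zero, mul_zero]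
  have h4 : N * D = D * N := by
    calc N * D = N * D * (gramW n * N) := by rw [h1, mul_one]
      _ = N * (D * gramW n) * N := by simp only [Matrix.mul_assoc]
      _ = N * gramW n * D * N := by rw [← h3]; simp only [Matrix.mul_assoc]
      _ = D * N := by rw [h2, one_mul]
  have h5 := congrFun (congrFun h4 lam) mu
  rw [Matrix.mul_diagonal, Matrix.diagonal_mul, mul_comm] at h5
  have h6 : (((rParts mu).sum : ℚ) - (rParts lam).sum) * N lam mu = 0 := by
    rw [sub_mul, h5, sub_self]
  exact (mul_eq_zero.1 h6).resolve_left (sub_ne_zero.2 (by exact_mod_cast h.symm))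

theorem abs_det_block {A : Matrix n.Partition n.Partition ℚ} (hA : IsTransitionMatrix A)
    {n₀ n₁ : ℕ} (h : n₀ + 2 * n₁ = n) :
    |(block A n₀ n₁).det| = (2 : ℚ) ^ (∑ lam : PairPart n n₀ n₁,
      ((len (glaisher (rPart lam.1)) : ℤ) - (len (rPart lam.1) : ℤ) +
        (len (dPart lam.1) : ℤ))) := by
  -- Since `Gram(W)` is block diagonal, restricting `Gram(W) · ᵗA A = 1` to a block loses no
  -- summand.
  have h1 : gramBlock n n₀ n₁ * block A n₀ n₁ = 1 := by
    ext lam mu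
    have h2 := congrFun (congrFun (gramW_mul_eq_one hA) lam.1) mu.1
    rw [Matrix.one_apply] at h2 ⊢
    simp only [Subtype.ext_iff]
    rw [← h2, Matrix.mul_apply, Matrix.mul_apply]
    refine sum_pairPart h (f := fun nu => gramW n lam.1 nu * (Aᵀ * A) nu mu.1) fun nu hnu => ?_
    rw [gramW, Matrix.of_apply, pair_compoundW_eq_zero (by rw [lam.2.1]; exact hnu.symm), zero_mul]
  have h2 := congrArg Matrix.det h1
  rw [Matrix.det_mul, Matrix.det_one, det_gramBlock h, zpow_neg,
    inv_mul_eq_one₀ (zpow_ne_zero _ two_ne_zero)] at h2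
  rw [← h2, abs_of_pos (by positivity)]

end Transition

end Compound

end

theorem mainTheorem2 (n : ℕ) :
    ∃ A : Matrix n.Partition n.Partition ℚ,
      -- `A` is the transition matrix `A_n`, and it is unique
      (Compound.IsTransitionMatrix A ∧
        ∀ A' : Matrix n.Partition n.Partition ℚ, Compound.IsTransitionMatrix A' → A' = A) ∧
      -- the sets `P(n₀, n₁)` with `n₀ + 2 n₁ = n` decompose the index set,
      -- and `ᵗA A` vanishes outside the corresponding diagonal blocks
      (∀ lam : n.Partition, ∃! p : ℕ × ℕ, p.1 + 2 * p.2 = n ∧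
        (Compound.rParts lam).sum = p.1 ∧ (Compound.dParts lam).sum = p.2) ∧
      (∀ n₀ n₁ m₀ m₁ : ℕ, n₀ + 2 * n₁ = n → m₀ + 2 * m₁ = n → (n₀, n₁) ≠ (m₀, m₁) →
        ∀ (lam : Compound.PairPart n n₀ n₁) (mu : Compound.PairPart n m₀ m₁),
          (Aᵀ * A) lam.1 mu.1 = 0) ∧
      -- the principal block is `G_n = ᵗΓ Γ`, where `Γ` consists of the Stembridge coefficients
      (∀ lam : n.Partition, Compound.killEven (Compound.schurS lam) =
        ∑ mu : Compound.StrictPart n, Compound.stembridge A lam mu • Compound.schurQ mu.1) ∧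
      ((Compound.block A n 0).submatrix (Compound.strictEquiv n) (Compound.strictEquiv n) =
        (Compound.stembridge A)ᵀ * Compound.stembridge A) ∧
      -- the determinants of the blocks
      (∀ n₀ n₁ : ℕ, n₀ + 2 * n₁ = n →
        |(Compound.block A n₀ n₁).det| =
          (2 : ℚ) ^ (∑ lam : Compound.PairPart n n₀ n₁,
            ((Compound.len (Compound.glaisher (Compound.rPart lam.1)) : ℤ)
              - (Compound.len (Compound.rPart lam.1) : ℤ)
              + (Compound.len (Compound.dPart lam.1) : ℤ)))) := by
  let A : Matrix n.Partition n.Partition ℚ :=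
    Compound.charTable n * (Compound.coeffW n)⁻¹
  have hA : Compound.IsTransitionMatrix A := by
    rw [Compound.isTransitionMatrix_iff,
      Matrix.nonsing_inv_mul_cancel_right _ _ (Compound.isUnit_det_coeffW n)]
  refine ⟨A, ⟨hA, fun A' hA' => ?_⟩, fun lam => ?_, ?_, fun lam => ?_, ?_, ?_⟩
  · rw [Compound.isTransitionMatrix_iff] at hA'
    simp only [A]
    rw [hA', Matrix.mul_nonsing_inv_cancel_right _ _ (Compound.isUnit_det_coeffW n)]
  · exact ⟨((Compound.rParts lam).sum, (Compound.dParts lam).sum),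
      ⟨Compound.rParts_sum_add lam, rfl, rfl⟩, fun p hp => Prod.ext hp.2.1.symm hp.2.2.symm⟩
  · intro n₀ n₁ m₀ m₁ h h' hne lam mu
    refine Compound.transpose_mul_self_eq_zero hA ?_
    rw [lam.2.1, mu.2.1]
    intro h0
    exact hne (Prod.ext h0 (by dsimp only; omega))
  · rw [hA lam, map_sum]
    simp only [map_smul, Compound.killEven_compoundW, smul_ite, smul_zero]
    rw [← Finset.sum_filter]
    exact Finset.sum_subtype _ (by simp) _
  · ext lam mu
    rfl
  · exact fun n₀ n₁ h => Compound.abs_det_block hA h
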